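/- Let $\mathcal G$ be a connected metric graph with vertex set $\mathbb V$ and an at most countable edge set $\mathbb E$ (loops and multiple edges are allowed; each edge $e$ is identified with $[0,|e|]$, or with $[0,\infty)$ if it is a half-line, in which case $|e|=\infty$ and $e$ has only one vertex, at $0$), such that every vertex has finite degree and $\inf_{e\in\mathbb E}|e|>0$. Assume that one of the following holds: (i) $\mathcal G$ has finitely many edges, at least one of which is a half-line; or (ii) $\mathcal G$ is periodic: it has infinitely many edges, their lengths are bounded from above, and for some $n\ge 1$ the group $\mathbb Z^n$ acts on $\mathcal G$ by automorphisms of metric graphs (preserving incidence and edge lengths), freely (no nonzero group element fixes a point of $\mathcal G$) and with finitely many orbits of edges. Let $p>6$. For $\rho\in[1/2,1]$ and $u\in H^1(\mathcal G)$ set $$E_\rho(u,\mathcal G)=\frac12\|u'\|_{L^2(\mathcal G)}^2-\frac{\rho}{p}\|u\|_{L^p(\mathcal G)}^p,\qquad E(u,\mathcal G)=E_1(u,\mathcal G),$$ and consider the problem $$\begin{cases}u''+\rho\,u^{p-1}=\lambda u & \text{on every } e\in\mathbb E,\\ u\in H^1(\mathcal G),\quad u>0 & \text{on }\mathcal G,\\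 \sum_{e\succ v}\frac{du}{dx_e}(v)=0 & \text{for every } v\in\mathbb V,\end{cases}\qquad(\mathrm{NLS}_\rho)$$ where the last sum is over the edges $e$ incident at $v$ (a loop at $v$ is counted twice) and $\frac{du}{dx_e}(v)$ is the derivative of $u$ at $v$ along $e$ in the direction pointing away from $v$. Then there exists $\tilde\mu=\tilde\mu(\mathcal G,p)>0$ such that, for every $\mu\in(0,\tilde\mu]$, the following hold: 1. if $u$ solves $(\mathrm{NLS}_1)$ for some $\lambda\in\mathbb R$ and $\|u\|_{L^2(\mathcal G)}^2=\mu$, then $E(u,\mathcal G)>0$; 2. for every $\rho\in[1/2,1]$, if $u$ solves $(\mathrm{NLS}_\rho)$ for some $\lambda\in\mathbb R$ and $\|u\|_{L^2(\mathcal G)}^2=\mu$, then $E_\rho(u,\mathcal G)>0$. -/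

import Mathlib

open MeasureTheory

/-- A metric graph with vertex set `V` and edge set `E`; loops and multiple edges are allowed.
The edge `e` is identified with the interval `[0, length e]`, or with `[0, ∞)` if it is a half-line.
The vertex at `0` is `init e`; a bounded edge also has a vertex `term e` at `length e`, whereas a
half-line has no second vertex. -/
structure MetricGraph (V E : Type*) where
  /-- the length of an edge, infinite for a half-line -/
  length : E → ENNReal
  /-- the vertex at the coordinate `0` -/
  init : E → V
  /-- the vertex at the other end, if there is one -/
  term : E → Option V
  /-- exactly the half-lines have no second vertex -/
  term_eq_none_iff : ∀ e, term e = none ↔ length e = ⊤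

namespace MetricGraph

variable {V E : Type*}

/-- The closed interval of coordinates of the points of `e`, endpoints included. -/
def edge (G : MetricGraph V E) (e : E) : Set ℝ :=
  {x | 0 ≤ x ∧ ENNReal.ofReal x ≤ G.length e}

/-- The open interval of coordinates of the interior points of `e`. -/
def edgeInterior (G : MetricGraph V E) (e : E) : Set ℝ :=
  {x | 0 < x ∧ ENNReal.ofReal x < G.length e}

/-- The coordinate of the second endpoint of a bounded edge (only used for bounded edges). -/
def endCoord (G : MetricGraph V E) (e : E) : ℝ := (G.length e).toReal

/-- `v` and `w` are the two ends of some bounded edge. -/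
def Joined (G : MetricGraph V E) (v w : V) : Prop :=
  ∃ e, G.init e = v ∧ G.term e = some w

/-- The class of admissible graphs: connected, at most countably many edges, every vertex of finite
degree, and edge lengths bounded away from zero. -/
structure IsAdmissible (G : MetricGraph V E) : Prop where
  connected : ∀ v w : V, Relation.EqvGen G.Joined v w
  countable_edges : Countable E
  finite_degree : ∀ v : V, {e | G.init e = v ∨ G.term e = some v}.Finite
  length_bounded_below : ∃ e₀ : ℝ, 0 < e₀ ∧ ∀ e, ENNReal.ofReal e₀ ≤ G.length e

/-- Noncompact graphs with finitely many edges: at least one of the edges is a half-line. -/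
def IsNoncompactFinite (G : MetricGraph V E) : Prop :=
  Finite E ∧ ∃ e, G.length e = ⊤

/-- A free cocompact action of the group `ℤⁿ` on the infinite graph `G` by automorphisms of metric
graphs. An automorphism need not respect the orientations of the edges given by the coordinates.
(Freeness on the points of `G` is freeness on vertices and edges, because a group element that maps
an edge to itself fixes the edge or its midpoint. Cocompactness says that the edges are bounded and
form finitely many orbits.) -/
structure IsPeriodicAction (G : MetricGraph V E) (n : ℕ)
    [AddAction (Fin n → ℤ) V] [AddAction (Fin n → ℤ) E] : Prop where
  infinite_edges : Infinite E
  length_bounded_above : ∃ C : ℝ, ∀ e, G.length e ≤ ENNReal.ofReal C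
  length_vadd : ∀ (g : Fin n → ℤ) (e : E), G.length (g +ᵥ e) = G.length e
  ends_vadd : ∀ (g : Fin n → ℤ) (e : E),
    (G.init (g +ᵥ e) = g +ᵥ G.init e ∧ G.term (g +ᵥ e) = (G.term e).map (fun v => g +ᵥ v)) ∨
    (G.term (g +ᵥ e) = some (g +ᵥ G.init e) ∧
      some (G.init (g +ᵥ e)) = (G.term e).map (fun v => g +ᵥ v))
  free_vertices : ∀ (g : Fin n → ℤ) (v : V), g +ᵥ v = v → g = 0
  free_edges : ∀ (g : Fin n → ℤ) (e : E), g +ᵥ e = e → g = 0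
  finite_orbits : ∃ F : Set E, F.Finite ∧ ∀ e, ∃ g : Fin n → ℤ, ∃ f ∈ F, e = g +ᵥ f

/-- Periodic graphs: infinite graphs that are `ℤⁿ`-periodic for some `n`. (As the edge set is
infinite, `n` is necessarily positive.) -/
def IsPeriodic (G : MetricGraph V E) : Prop :=
  ∃ (n : ℕ) (_ : AddAction (Fin n → ℤ) V) (_ : AddAction (Fin n → ℤ) E), G.IsPeriodicAction n

/-! A real function on `G` is represented by the family `u : E → ℝ → ℝ` of its restrictions to the
edges; only the values `u e x` with `x ∈ G.edge e` matter. -/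

/-- The restrictions agree at the vertices, so that they form one function on `G`. -/
def AgreesAtVertices (G : MetricGraph V E) (u : E → ℝ → ℝ) : Prop :=
  ∃ f : V → ℝ, ∀ e, u e 0 = f (G.init e) ∧ ∀ v, G.term e = some v → u e (G.endCoord e) = f v

/-- The integral over `G`. -/
noncomputable def integral (G : MetricGraph V E) (f : E → ℝ → ℝ) : ℝ :=
  ∑' e, ∫ x in G.edge e, f e x

/-- `f ∈ L²(G)`. -/
def MemL2 (G : MetricGraph V E) (f : E → ℝ → ℝ) : Prop :=
  (∀ e, MemLp (f e) 2 (volume.restrict (G.edge e))) ∧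
    Summable (fun e => ∫ x in G.edge e, f e x ^ 2)

/-- `u ∈ H¹(G)`: `u` is continuous on `G`, (locally) absolutely continuous on every edge, and `u`
and `u'` are in `L²(G)`. The derivative of an absolutely continuous function exists almost
everywhere and is its weak derivative. -/
structure MemH1 (G : MetricGraph V E) (u : E → ℝ → ℝ) : Prop where
  agreesAtVertices : G.AgreesAtVertices u
  absolutelyContinuous : ∀ e, ∀ a ∈ G.edge e, ∀ b ∈ G.edge e,
    AbsolutelyContinuousOnInterval (u e) a b
  memL2 : G.MemL2 u
  memL2_deriv : G.MemL2 (fun e => deriv (u e))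

/-- The mass `‖u‖₂²`. -/
noncomputable def mass (G : MetricGraph V E) (u : E → ℝ → ℝ) : ℝ :=
  G.integral (fun e x => u e x ^ 2)

/-- The energy `E_ρ(u, G) = 1/2 ‖u'‖₂² - ρ/p ‖u‖_p^p` of a function `u ∈ H¹(G)`; the energy
`E(u, G)` is the case `ρ = 1`. Both norms are finite for `u ∈ H¹(G)` when `G` is admissible and
`2 ≤ p`, because `H¹(G)` embeds in `L²(G) ∩ L^∞(G)`. -/
noncomputable def energy (G : MetricGraph V E) (p ρ : ℝ) (u : E → ℝ → ℝ) : ℝ :=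
  1 / 2 * G.integral (fun e x => deriv (u e) x ^ 2)
    - ρ / p * G.integral (fun e x => |u e x| ^ p)

/-- The sum of the outgoing derivatives of `u` at `v` along the edges incident at `v`; a loop
contributes at both of its ends. The sums are finite in a graph of finite degree. -/
noncomputable def outgoingDerivSum (G : MetricGraph V E) (u : E → ℝ → ℝ) (v : V) : ℝ :=
  (∑ᶠ e ∈ {e | G.init e = v}, derivWithin (u e) (G.edge e) 0) +
    ∑ᶠ e ∈ {e | G.term e = some v}, -derivWithin (u e) (G.edge e) (G.endCoord e)

/-- `u` is a positive solution of the NLS problem `u'' + ρ u^(p-1) = l u` on every edge, with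
Kirchhoff conditions at the vertices: it is a function in `H¹(G)`, positive on all of `G`,
differentiable on the closed edges (one-sidedly at the endpoints), and twice differentiable in the
interior of every edge, where it satisfies the equation. -/
structure IsSolution (G : MetricGraph V E) (p ρ l : ℝ) (u : E → ℝ → ℝ) : Prop where
  memH1 : G.MemH1 u
  pos : ∀ e, ∀ x ∈ G.edge e, 0 < u e x
  differentiableOn : ∀ e, DifferentiableOn ℝ (u e) (G.edge e)
  differentiableAt_deriv : ∀ e, ∀ x ∈ G.edgeInterior e, DifferentiableAt ℝ (deriv (u e)) x
  equation : ∀ e, ∀ x ∈ G.edgeInterior e,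
    deriv (deriv (u e)) x + ρ * u e x ^ (p - 1) = l * u e x
  kirchhoff : ∀ v, G.outgoingDerivSum u v = 0

end MetricGraph

/-! Write `μ`, `A`, `B` for the integrals of `u²`, `u'²`, `u^p` over the graph, and suppose that the
energy is nonpositive, so that `A ≤ (2ρ/p) B ≤ B`. The graph has points where `u` is arbitrarily
small, hence `u² ≤ 3 (t μ + A / t)` everywhere, for every `t > 0` (`sq_le`). Optimizing in `t` and
using `p > 6` and `μ < 1/6`, one finds that `B μ` is bounded below: a solution of small mass and
nonpositive energy has a large `B`.

Two identities then compete. Testing the equation with `u` gives `A + l μ = ρ B`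
(`integral_identity`). On each edge the first integral `u'²/2 + (ρ/p) u^p - (l/2) u²` is constant.
It vanishes on a half-line; on a bounded edge, if it is `-c < 0`, integrating `(log u)''` bounds `c`
(`neg_energy_le`). Summing over the edges bounds `A/2 + (ρ/p) B - (l/2) μ` below by errors that are
`O(μ B)`, since `√l μ ≤ √(B μ)` and `B μ` is not small. Eliminating `l μ` and using `A ≤ (2ρ/p) B`
leaves `(p - 6)/(4p) · B ≤ C μ B`, with `C` depending only on the lower bound for the edge lengths.
This is false for small `μ`. -/

/-! ### Regularity of solutions up to the endpoints of an edge -/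

/-- A function with bounded second derivative on an open interval has a derivative that extends
continuously, and the extension gives the one-sided derivatives at the endpoints. -/
theorem exists_continuous_extension_deriv {f : ℝ → ℝ} {a b C : ℝ} (hab : a < b)
    (hf : ContinuousOn f (Set.Icc a b)) (hd : DifferentiableOn ℝ f (Set.Ioo a b))
    (h2 : ∀ x ∈ Set.Ioo a b, DifferentiableAt ℝ (deriv f) x)
    (hC : ∀ x ∈ Set.Ioo a b, |deriv (deriv f) x| ≤ C) :
    ∃ W : ℝ → ℝ, Continuous W ∧ (∀ x ∈ Set.Ioo a b, deriv f x = W x) ∧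
      HasDerivWithinAt f (W a) (Set.Ici a) a ∧ HasDerivWithinAt f (W b) (Set.Iic b) b := by
  have hLip : LipschitzOnWith C.toNNReal (deriv f) (Set.Ioo a b) := by
    refine Convex.lipschitzOnWith_of_nnnorm_deriv_le h2 (fun x hx => ?_) (convex_Ioo a b)
    rw [← NNReal.coe_le_coe, coe_nnnorm, Real.norm_eq_abs]
    exact (hC x hx).trans (Real.le_coe_toNNReal C)
  obtain ⟨W, hW, hEq⟩ := hLip.extend_real
  have hWc := hW.continuous
  refine ⟨W, hWc, hEq, ?_, ?_⟩
  · refine hasDerivWithinAt_Ici_of_tendsto_deriv hd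
      ((hf a (Set.left_mem_Icc.2 hab.le)).mono Set.Ioo_subset_Icc_self)
      (Ioo_mem_nhdsGT hab) ?_
    exact ((hWc.tendsto a).mono_left nhdsWithin_le_nhds).congr'
      (Filter.eventually_of_mem (Ioo_mem_nhdsGT hab) fun x hx => (hEq hx).symm)
  · refine hasDerivWithinAt_Iic_of_tendsto_deriv hd
      ((hf b (Set.right_mem_Icc.2 hab.le)).mono Set.Ioo_subset_Icc_self)
      (Ioo_mem_nhdsLT hab) ?_
    exact ((hWc.tendsto b).mono_left nhdsWithin_le_nhds).congr'
      (Filter.eventually_of_mem (Ioo_mem_nhdsLT hab) fun x hx => (hEq hx).symm)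

/-- A positive solution `f` of `f'' + ρ f^(p-1) = l f` on an interval `S`, with its derivative `w`,
both continuous up to the endpoints. -/
structure IsNLSProfile (p ρ l : ℝ) (S : Set ℝ) (f w : ℝ → ℝ) : Prop where
  pos : ∀ x ∈ S, 0 < f x
  continuousOn : ContinuousOn f S
  continuousOn_deriv : ContinuousOn w S
  hasDerivAt : ∀ x ∈ interior S, HasDerivAt f (w x) x
  hasDerivAt_deriv : ∀ x ∈ interior S, HasDerivAt w (l * f x - ρ * f x ^ (p - 1)) x

/-- The equation expresses `f''` through `f`, and positivity makes this expression continuous on the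
compact interval. -/
theorem abs_deriv_deriv_bounded_of_equation {f : ℝ → ℝ} {p ρ l a b : ℝ}
    (hf : ContinuousOn f (Set.Icc a b)) (hpos : ∀ x ∈ Set.Icc a b, 0 < f x)
    (heq : ∀ x ∈ Set.Ioo a b, deriv (deriv f) x + ρ * f x ^ (p - 1) = l * f x) :
    ∃ C, ∀ x ∈ Set.Ioo a b, |deriv (deriv f) x| ≤ C := by
  have hc : ContinuousOn (fun x => l * f x - ρ * f x ^ (p - 1)) (Set.Icc a b) :=
    (continuousOn_const.mul hf).sub
      (continuousOn_const.mul (hf.rpow_const fun x hx => Or.inl (hpos x hx).ne'))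
  obtain ⟨C, hC⟩ := isCompact_Icc.exists_bound_of_continuousOn hc
  refine ⟨C, fun x hx => ?_⟩
  have := hC x (Set.Ioo_subset_Icc_self hx)
  rwa [← heq x hx, add_sub_cancel_right] at this

theorem isNLSProfile_Icc {f : ℝ → ℝ} {p ρ l L : ℝ} (hL : 0 < L)
    (hd : DifferentiableOn ℝ f (Set.Icc 0 L)) (hpos : ∀ x ∈ Set.Icc 0 L, 0 < f x)
    (h2 : ∀ x ∈ Set.Ioo 0 L, DifferentiableAt ℝ (deriv f) x)
    (heq : ∀ x ∈ Set.Ioo 0 L, deriv (deriv f) x + ρ * f x ^ (p - 1) = l * f x) :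
    IsNLSProfile p ρ l (Set.Icc 0 L) f (derivWithin f (Set.Icc 0 L)) := by
  obtain ⟨C, hC⟩ := abs_deriv_deriv_bounded_of_equation hd.continuousOn hpos heq
  obtain ⟨W, hW, hWd, hW0, hWL⟩ := exists_continuous_extension_deriv hL hd.continuousOn
    (hd.mono Set.Ioo_subset_Icc_self) h2 hC
  have hda : ∀ x ∈ Set.Ioo 0 L, HasDerivAt f (W x) x := fun x hx => by
    rw [← hWd x hx]
    exact ((hd x (Set.Ioo_subset_Icc_self hx)).differentiableAt
      (Icc_mem_nhds hx.1 hx.2)).hasDerivAt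
  have hEq : Set.EqOn (derivWithin f (Set.Icc 0 L)) W (Set.Icc 0 L) := by
    intro x hx
    have hu := uniqueDiffOn_Icc hL x hx
    rcases hx.1.eq_or_lt with rfl | h0
    · exact (hW0.mono Set.Icc_subset_Ici_self).derivWithin hu
    rcases hx.2.eq_or_lt with rfl | hxL
    · exact (hWL.mono Set.Icc_subset_Iic_self).derivWithin hu
    · exact (hda x ⟨h0, hxL⟩).hasDerivWithinAt.derivWithin hu
  refine ⟨hpos, hd.continuousOn, hW.continuousOn.congr hEq, ?_, ?_⟩ <;> rw [interior_Icc]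
  · intro x hx
    rw [hEq (Set.Ioo_subset_Icc_self hx)]
    exact hda x hx
  · intro x hx
    have h := (h2 x hx).hasDerivAt
    rw [show deriv (deriv f) x = l * f x - ρ * f x ^ (p - 1) by linarith [heq x hx]] at h
    refine h.congr_of_eventuallyEq ?_
    filter_upwards [Ioo_mem_nhds hx.1 hx.2] with y hy
    rw [hEq (Set.Ioo_subset_Icc_self hy), hWd y hy]

theorem isNLSProfile_Ici {f : ℝ → ℝ} {p ρ l : ℝ}
    (hd : DifferentiableOn ℝ f (Set.Ici 0)) (hpos : ∀ x ∈ Set.Ici 0, 0 < f x)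
    (h2 : ∀ x ∈ Set.Ioi 0, DifferentiableAt ℝ (deriv f) x)
    (heq : ∀ x ∈ Set.Ioi 0, deriv (deriv f) x + ρ * f x ^ (p - 1) = l * f x) :
    IsNLSProfile p ρ l (Set.Ici 0) f (derivWithin f (Set.Ici 0)) := by
  -- Only the endpoint `0` needs the extension argument, which is local there; the interval `[0, 1]`
  -- suffices.
  have hI : Set.Icc (0 : ℝ) 1 ⊆ Set.Ici 0 := Set.Icc_subset_Ici_self
  have hI' : Set.Ioo (0 : ℝ) 1 ⊆ Set.Ioi 0 := Set.Ioo_subset_Ioi_self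
  obtain ⟨C, hC⟩ := abs_deriv_deriv_bounded_of_equation (hd.continuousOn.mono hI)
    (fun x hx => hpos x (hI hx)) (fun x hx => heq x (hI' hx))
  obtain ⟨W, hW, hWd, hW0, -⟩ := exists_continuous_extension_deriv one_pos
    (hd.continuousOn.mono hI) (hd.mono (hI'.trans Set.Ioi_subset_Ici_self))
    (fun x hx => h2 x (hI' hx)) hC
  have hEq : ∀ x ∈ Set.Ioi (0 : ℝ), derivWithin f (Set.Ici 0) x = deriv f x := fun x hx =>
    derivWithin_of_mem_nhds (Ici_mem_nhds hx)
  have hEq0 : derivWithin f (Set.Ici 0) 0 = W 0 :=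
    hW0.derivWithin (uniqueDiffOn_Ici 0 0 Set.self_mem_Ici)
  have hww : ∀ x ∈ Set.Ioi (0 : ℝ),
      HasDerivAt (derivWithin f (Set.Ici 0)) (l * f x - ρ * f x ^ (p - 1)) x := by
    intro x hx
    have h := (h2 x hx).hasDerivAt
    rw [show deriv (deriv f) x = l * f x - ρ * f x ^ (p - 1) by linarith [heq x hx]] at h
    refine h.congr_of_eventuallyEq ?_
    filter_upwards [Ioi_mem_nhds hx] with y hy
    exact hEq y hy
  refine ⟨hpos, hd.continuousOn, ?_, ?_, ?_⟩
  · intro x hx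
    rcases (Set.mem_Ici.1 hx).eq_or_lt with rfl | h0
    · have h1 : ContinuousWithinAt (derivWithin f (Set.Ici 0)) (Set.Ico 0 1) 0 := by
        refine hW.continuousWithinAt.congr (fun y hy => ?_) hEq0
        rcases hy.1.eq_or_lt with rfl | h
        · exact hEq0
        · rw [hEq y h, hWd y ⟨h, hy.2⟩]
      exact h1.mono_of_mem_nhdsWithin (Ico_mem_nhdsGE one_pos)
    · exact (hww x h0).continuousAt.continuousWithinAt
  · rw [interior_Ici]
    intro x hx
    rw [hEq x hx]
    exact ((hd x (Set.Ioi_subset_Ici_self hx)).differentiableAt (Ici_mem_nhds hx)).hasDerivAt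
  · rwa [interior_Ici]

/-! ### Identities for a profile on one interval -/

namespace IsNLSProfile

variable {p ρ l : ℝ} {S : Set ℝ} {f w : ℝ → ℝ}

theorem continuousOn_rpow (h : IsNLSProfile p ρ l S f w) (q : ℝ) :
    ContinuousOn (fun x => f x ^ q) S :=
  h.continuousOn.rpow_const fun x hx => Or.inl (h.pos x hx).ne'

theorem self_mul_rpow (h : IsNLSProfile p ρ l S f w) {x : ℝ} (hx : x ∈ S) :
    f x * f x ^ (p - 1) = f x ^ p := by
  have := Real.rpow_add (h.pos x hx) 1 (p - 1)
  rw [Real.rpow_one] at this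
  rw [← this]; congr 1; ring

/-- The oscillation of `f²` is controlled by the Dirichlet and mass integrals. -/
theorem abs_sq_sub_sq_le (h : IsNLSProfile p ρ l S f w) (hS : S.OrdConnected)
    (hf : IntegrableOn (fun x => f x ^ 2) S) (hw : IntegrableOn (fun x => w x ^ 2) S)
    {t : ℝ} (ht : 0 < t) {x y : ℝ} (hx : x ∈ S) (hy : y ∈ S) :
    |f x ^ 2 - f y ^ 2| ≤ t * (∫ z in S, f z ^ 2) + (∫ z in S, w z ^ 2) / t := by
  wlog hxy : x ≤ y generalizing x y
  · rw [abs_sub_comm]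
    exact this hy hx (le_of_not_ge hxy)
  have hsub : Set.Icc x y ⊆ S := hS.out hx hy
  have hc : ContinuousOn (fun z => 2 * f z * w z) (Set.Icc x y) :=
    ((continuousOn_const.mul h.continuousOn).mul h.continuousOn_deriv).mono hsub
  have hFTC : ∫ z in x..y, 2 * f z * w z = f y ^ 2 - f x ^ 2 := by
    refine intervalIntegral.integral_eq_sub_of_hasDerivAt_of_le (f := fun z => f z ^ 2) hxy
      ((h.continuousOn.pow 2).mono hsub) (fun z hz => ?_) ?_
    · have hz' : z ∈ interior S := interior_mono hsub (by rwa [interior_Icc])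
      exact ((h.hasDerivAt z hz').pow 2).congr_deriv (by simp)
    · exact hc.intervalIntegrable_of_Icc hxy
  have hint : IntegrableOn (fun z => t * f z ^ 2 + w z ^ 2 / t) S :=
    (hf.const_mul t).add (hw.div_const t)
  -- Young's inequality for `(f²)' = 2 f f'`; `t` stays free so that it can be optimized later.
  have hpt : ∀ z, |2 * f z * w z| ≤ t * f z ^ 2 + w z ^ 2 / t := by
    intro z
    have e1 : t * f z ^ 2 + w z ^ 2 / t - 2 * f z * w z = (t * f z - w z) ^ 2 / t := by
      field_simp; ring
    have e2 : t * f z ^ 2 + w z ^ 2 / t + 2 * f z * w z = (t * f z + w z) ^ 2 / t := by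
      field_simp; ring
    have p1 : 0 ≤ (t * f z - w z) ^ 2 / t := by positivity
    have p2 : 0 ≤ (t * f z + w z) ^ 2 / t := by positivity
    rw [abs_le]; constructor <;> linarith
  rw [abs_sub_comm, ← hFTC, intervalIntegral.integral_of_le hxy]
  calc |∫ z in Set.Ioc x y, 2 * f z * w z|
      ≤ ∫ z in Set.Ioc x y, |2 * f z * w z| := abs_integral_le_integral_abs
    _ ≤ ∫ z in Set.Ioc x y, (t * f z ^ 2 + w z ^ 2 / t) := by
        refine setIntegral_mono_on ?_ (hint.mono_set (Set.Ioc_subset_Icc_self.trans hsub))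
          measurableSet_Ioc fun z _ => hpt z
        exact ((hc.integrableOn_Icc).mono_set Set.Ioc_subset_Icc_self).abs
    _ ≤ ∫ z in S, (t * f z ^ 2 + w z ^ 2 / t) := by
        refine setIntegral_mono_set hint (Filter.Eventually.of_forall fun z => ?_)
          (Filter.Eventually.of_forall (Set.Ioc_subset_Icc_self.trans hsub))
        have : 0 ≤ t * f z ^ 2 + w z ^ 2 / t := by positivity
        exact this
    _ = _ := by
        rw [integral_add (hf.const_mul t) (hw.div_const t), integral_const_mul, integral_div]

theorem hasDerivAt_mul (h : IsNLSProfile p ρ l S f w) {x : ℝ} (hx : x ∈ interior S) :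
    HasDerivAt (fun z => f z * w z) (w x ^ 2 + l * f x ^ 2 - ρ * f x ^ p) x := by
  refine ((h.hasDerivAt x hx).mul (h.hasDerivAt_deriv x hx)).congr_deriv ?_
  rw [← h.self_mul_rpow (interior_subset hx)]
  ring

/-- The derivative is `w (w' + ρ f^(p-1) - l f)`, and the bracket is zero by the equation. -/
theorem hasDerivAt_energy (h : IsNLSProfile p ρ l S f w) (hp : p ≠ 0) {x : ℝ}
    (hx : x ∈ interior S) :
    HasDerivAt (fun z => 1 / 2 * w z ^ 2 + ρ / p * f z ^ p - l / 2 * f z ^ 2) 0 x := by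
  have hf := h.hasDerivAt x hx
  have hw := h.hasDerivAt_deriv x hx
  have h1 := ((hw.pow 2).const_mul (1 / 2)).add
    ((hf.rpow_const (p := p) (Or.inl (h.pos x (interior_subset hx)).ne')).const_mul (ρ / p))
  refine (h1.sub ((hf.pow 2).const_mul (l / 2))).congr_deriv ?_
  simp only [Nat.cast_ofNat, Nat.add_one_sub_one, pow_one]
  field_simp
  ring

/-- The first integral of the equation. -/
theorem energy_const (h : IsNLSProfile p ρ l S f w) (hp : p ≠ 0) (hS : S.OrdConnected) {x y : ℝ}
    (hx : x ∈ S) (hy : y ∈ S) :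
    1 / 2 * w x ^ 2 + ρ / p * f x ^ p - l / 2 * f x ^ 2 =
      1 / 2 * w y ^ 2 + ρ / p * f y ^ p - l / 2 * f y ^ 2 := by
  wlog hxy : x ≤ y generalizing x y
  · exact (this hy hx (le_of_not_ge hxy)).symm
  have hsub : Set.Icc x y ⊆ S := hS.out hx hy
  have hc : ContinuousOn (fun z => 1 / 2 * w z ^ 2 + ρ / p * f z ^ p - l / 2 * f z ^ 2) S :=
    ((continuousOn_const.mul (h.continuousOn_deriv.pow 2)).add
      (continuousOn_const.mul (h.continuousOn_rpow p))).sub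
      (continuousOn_const.mul (h.continuousOn.pow 2))
  have := intervalIntegral.integral_eq_sub_of_hasDerivAt_of_le (f' := fun _ => (0 : ℝ)) hxy
    (hc.mono hsub) (fun z hz => h.hasDerivAt_energy hp
      (interior_mono hsub (by rwa [interior_Icc]))) (by simp)
  simp only [intervalIntegral.integral_zero] at this
  linarith

end IsNLSProfile

namespace IsNLSProfile

variable {p ρ l : ℝ} {S : Set ℝ} {f w : ℝ → ℝ}

/-! ### Bounded edges: flux bound and first integral -/

section Bounded

variable {L : ℝ}

theorem integrableOn_sq (h : IsNLSProfile p ρ l (Set.Icc 0 L) f w) :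
    IntegrableOn (fun x => f x ^ 2) (Set.Icc 0 L) :=
  (h.continuousOn.pow 2).integrableOn_Icc

theorem integrableOn_deriv_sq (h : IsNLSProfile p ρ l (Set.Icc 0 L) f w) :
    IntegrableOn (fun x => w x ^ 2) (Set.Icc 0 L) :=
  (h.continuousOn_deriv.pow 2).integrableOn_Icc

theorem integrableOn_rpow (h : IsNLSProfile p ρ l (Set.Icc 0 L) f w) (q : ℝ) :
    IntegrableOn (fun x => f x ^ q) (Set.Icc 0 L) :=
  (h.continuousOn_rpow q).integrableOn_Icc

/-- The equation tested with the solution itself, on a bounded interval. -/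
theorem integral_identity_Icc (h : IsNLSProfile p ρ l (Set.Icc 0 L) f w) (hL : 0 < L) :
    (∫ x in Set.Icc 0 L, w x ^ 2) + l * (∫ x in Set.Icc 0 L, f x ^ 2)
      - ρ * (∫ x in Set.Icc 0 L, f x ^ p) = f L * w L - f 0 * w 0 := by
  have hc : ContinuousOn (fun x => w x ^ 2 + l * f x ^ 2 - ρ * f x ^ p) (Set.Icc 0 L) :=
    ((h.continuousOn_deriv.pow 2).add (continuousOn_const.mul (h.continuousOn.pow 2))).sub
      (continuousOn_const.mul (h.continuousOn_rpow p))
  have := intervalIntegral.integral_eq_sub_of_hasDerivAt_of_le (f := fun z => f z * w z) hL.le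
    (h.continuousOn.mul h.continuousOn_deriv)
    (fun z hz => h.hasDerivAt_mul (by rwa [interior_Icc])) (hc.intervalIntegrable_of_Icc hL.le)
  rw [← this, intervalIntegral.integral_of_le hL.le, ← integral_Icc_eq_integral_Ioc,
    integral_sub, integral_add, integral_const_mul, integral_const_mul]
  · exact h.integrableOn_deriv_sq
  · exact h.integrableOn_sq.const_mul l
  · exact h.integrableOn_deriv_sq.add (h.integrableOn_sq.const_mul l)
  · exact (h.integrableOn_rpow p).const_mul ρ

/-- The flux `f f'` is controlled pointwise by integrals over the interval. -/
theorem abs_mul_deriv_le (h : IsNLSProfile p ρ l (Set.Icc 0 L) f w) (hL : 0 < L) {x : ℝ}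
    (hx : x ∈ Set.Icc 0 L) :
    |f x * w x| ≤ ((∫ z in Set.Icc 0 L, f z ^ 2) + (∫ z in Set.Icc 0 L, w z ^ 2)) / L
      + ((∫ z in Set.Icc 0 L, w z ^ 2) + |l| * (∫ z in Set.Icc 0 L, f z ^ 2)
        + |ρ| * (∫ z in Set.Icc 0 L, f z ^ p)) := by
  set K := (∫ z in Set.Icc 0 L, w z ^ 2) + |l| * (∫ z in Set.Icc 0 L, f z ^ 2)
        + |ρ| * (∫ z in Set.Icc 0 L, f z ^ p) with hK
  have hc : ContinuousOn (fun x => w x ^ 2 + l * f x ^ 2 - ρ * f x ^ p) (Set.Icc 0 L) :=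
    ((h.continuousOn_deriv.pow 2).add (continuousOn_const.mul (h.continuousOn.pow 2))).sub
      (continuousOn_const.mul (h.continuousOn_rpow p))
  have hint : IntegrableOn (fun z => w z ^ 2 + |l| * f z ^ 2 + |ρ| * f z ^ p) (Set.Icc 0 L) :=
    (h.integrableOn_deriv_sq.add (h.integrableOn_sq.const_mul _)).add
      ((h.integrableOn_rpow p).const_mul _)
  have hKint : ∫ z in Set.Icc 0 L, (w z ^ 2 + |l| * f z ^ 2 + |ρ| * f z ^ p) = K := by
    rw [integral_add, integral_add, integral_const_mul, integral_const_mul]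
    · exact h.integrableOn_deriv_sq
    · exact h.integrableOn_sq.const_mul _
    · exact h.integrableOn_deriv_sq.add (h.integrableOn_sq.const_mul _)
    · exact (h.integrableOn_rpow p).const_mul _
  have hosc : ∀ a ∈ Set.Icc 0 L, ∀ b ∈ Set.Icc 0 L, a ≤ b → |f b * w b - f a * w a| ≤ K := by
    intro a ha b hb hab
    have hsub : Set.Icc a b ⊆ Set.Icc 0 L := Set.Icc_subset_Icc ha.1 hb.2
    have := intervalIntegral.integral_eq_sub_of_hasDerivAt_of_le (f := fun z => f z * w z) hab
      ((h.continuousOn.mul h.continuousOn_deriv).mono hsub)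
      (fun z hz => h.hasDerivAt_mul (interior_mono hsub (by rwa [interior_Icc])))
      ((hc.mono hsub).intervalIntegrable_of_Icc hab)
    rw [← this, intervalIntegral.integral_of_le hab, ← integral_Icc_eq_integral_Ioc, ← hKint]
    calc |∫ z in Set.Icc a b, (w z ^ 2 + l * f z ^ 2 - ρ * f z ^ p)|
        ≤ ∫ z in Set.Icc a b, |w z ^ 2 + l * f z ^ 2 - ρ * f z ^ p| :=
          abs_integral_le_integral_abs
      _ ≤ ∫ z in Set.Icc a b, (w z ^ 2 + |l| * f z ^ 2 + |ρ| * f z ^ p) := by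
          refine setIntegral_mono_on (hc.mono hsub).integrableOn_Icc.abs (hint.mono_set hsub)
            measurableSet_Icc fun z hz => ?_
          have h1 : |l * f z ^ 2| = |l| * f z ^ 2 := by rw [abs_mul, abs_sq]
          have h2 : |ρ * f z ^ p| = |ρ| * f z ^ p := by
            rw [abs_mul, abs_of_pos (Real.rpow_pos_of_pos (h.pos z (hsub hz)) p)]
          have h3 := abs_sub (w z ^ 2 + l * f z ^ 2) (ρ * f z ^ p)
          have h4 := abs_add_le (w z ^ 2) (l * f z ^ 2)
          rw [abs_sq] at h4
          linarith
      _ ≤ ∫ z in Set.Icc 0 L, (w z ^ 2 + |l| * f z ^ 2 + |ρ| * f z ^ p) := by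
          refine setIntegral_mono_set hint ?_ (Filter.Eventually.of_forall hsub)
          refine ae_restrict_of_forall_mem measurableSet_Icc fun z hz => ?_
          have := (Real.rpow_pos_of_pos (h.pos z hz) p).le
          exact add_nonneg (by positivity) (mul_nonneg (abs_nonneg _) this)
  -- The flux changes by at most `K` between any two points. Averaging this inequality over `y`
  -- produces the term divided by `L`.
  have hpt : ∀ y ∈ Set.Icc 0 L, |f x * w x| - K ≤ f y ^ 2 + w y ^ 2 := by
    intro y hy
    have h1 : |f x * w x - f y * w y| ≤ K := by
      rcases le_total x y with hxy | hxy
      · rw [abs_sub_comm]; exact hosc x hx y hy hxy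
      · exact hosc y hy x hx hxy
    have h2 := abs_sub_abs_le_abs_sub (f x * w x) (f y * w y)
    have h3 : |f y * w y| ≤ f y ^ 2 + w y ^ 2 := by
      rw [abs_le]
      constructor <;> nlinarith [sq_nonneg (f y + w y), sq_nonneg (f y - w y),
        sq_nonneg (f y), sq_nonneg (w y)]
    linarith
  have hmono : ∫ _ in Set.Icc 0 L, (|f x * w x| - K) ≤
      ∫ y in Set.Icc 0 L, (f y ^ 2 + w y ^ 2) :=
    setIntegral_mono_on (integrableOn_const (by simp)) (h.integrableOn_sq.add
      h.integrableOn_deriv_sq) measurableSet_Icc hpt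
  rw [integral_add h.integrableOn_sq h.integrableOn_deriv_sq, setIntegral_const] at hmono
  simp only [Measure.real, Real.volume_Icc, sub_zero, ENNReal.toReal_ofReal hL.le,
    smul_eq_mul] at hmono
  have : |f x * w x| - K ≤ ((∫ z in Set.Icc 0 L, f z ^ 2) + ∫ z in Set.Icc 0 L, w z ^ 2) / L := by
    rw [le_div_iff₀ hL]; linarith
  linarith

theorem integral_sq_pos (h : IsNLSProfile p ρ l (Set.Icc 0 L) f w) (hL : 0 < L) :
    0 < ∫ x in Set.Icc 0 L, f x ^ 2 := by
  rw [integral_Icc_eq_integral_Ioc, ← intervalIntegral.integral_of_le hL.le]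
  refine intervalIntegral.intervalIntegral_pos_of_pos_on
    ((h.continuousOn.pow 2).intervalIntegrable_of_Icc hL.le) (fun x hx => ?_) hL
  have := h.pos x (Set.Ioo_subset_Icc_self hx)
  positivity

/-- If the first integral of the equation is negative on a bounded interval, then its size is
controlled by integrating `(log f)''` and using Jensen's inequality. -/
theorem neg_energy_le (h : IsNLSProfile p ρ l (Set.Icc 0 L) f w) (hL : 0 < L) (hp : 2 < p)
    (hρ0 : 0 ≤ ρ) (hρ1 : ρ ≤ 1) {c : ℝ} (hc : 0 ≤ c)
    (hH : ∀ x ∈ Set.Icc 0 L, 1 / 2 * w x ^ 2 + ρ / p * f x ^ p - l / 2 * f x ^ 2 = -c) :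
    2 * c * L ≤ (∫ x in Set.Icc 0 L, f x ^ 2) *
      (2 * √l / L + 1 + (∫ x in Set.Icc 0 L, f x ^ p) / L) := by
  set M := ∫ x in Set.Icc 0 L, f x ^ 2 with hM
  set B := ∫ x in Set.Icc 0 L, f x ^ p with hB
  have hMpos : 0 < M := h.integral_sq_pos hL
  have hp0 : 0 < p := by linarith
  -- the logarithmic derivative is bounded
  have hlog : ∀ x ∈ Set.Icc 0 L, |w x / f x| ≤ √l := by
    intro x hx
    have hfx := h.pos x hx
    -- Since `c` and the power term are nonnegative, the first integral gives `w² ≤ l f²`; in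
    -- particular `l ≥ 0` here.
    refine Real.abs_le_sqrt ?_
    rw [div_pow, div_le_iff₀ (by positivity)]
    have h1 := hH x hx
    have h2 : 0 ≤ ρ / p * f x ^ p := by positivity
    linarith
  have hfrac : ∀ x ∈ Set.Icc 0 L, w x ^ 2 = l * f x ^ 2 - 2 * ρ / p * f x ^ p - 2 * c := by
    intro x hx
    have h1 := hH x hx
    have h2 : 2 * ρ / p * f x ^ p = 2 * (ρ / p * f x ^ p) := by ring
    linarith
  have hpow : ∀ x ∈ Set.Icc 0 L, f x ^ p = f x ^ (p - 2) * f x ^ 2 := by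
    intro x hx
    rw [← Real.rpow_natCast (f x) 2, ← Real.rpow_add (h.pos x hx)]
    norm_num
  -- This is `(log f)'' = f''/f - (f'/f)²`. Eliminating `f'²` by the first integral cancels `l` and
  -- makes `c` appear.
  have hder : ∀ x ∈ Set.Ioo 0 L, HasDerivAt (fun z => w z / f z)
      (2 * c / f x ^ 2 - ρ * (1 - 2 / p) * f x ^ (p - 2)) x := by
    intro x hx
    have hx' : x ∈ interior (Set.Icc 0 L) := by rwa [interior_Icc]
    have hxm := Set.Ioo_subset_Icc_self hx
    have hfx := h.pos x hxm
    refine ((h.hasDerivAt_deriv x hx').div (h.hasDerivAt x hx') hfx.ne').congr_deriv ?_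
    have e1 : (l * f x - ρ * f x ^ (p - 1)) * f x - w x * w x
        = 2 * c - ρ * (1 - 2 / p) * (f x ^ (p - 2) * f x ^ 2) := by
      rw [← hpow x hxm]
      have := h.self_mul_rpow hxm
      have h3 := hfrac x hxm
      have h4 : ρ * (1 - 2 / p) * f x ^ p = ρ * f x ^ p - 2 * ρ / p * f x ^ p := by ring
      rw [h4]
      linear_combination -ρ * this - h3
    rw [e1]
    field_simp
  have hcont2 : ContinuousOn (fun x => 2 * c / f x ^ 2) (Set.Icc 0 L) :=
    continuousOn_const.div (h.continuousOn.pow 2) fun x hx => by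
      have := h.pos x hx
      positivity
  have hcontp : ContinuousOn (fun x => ρ * (1 - 2 / p) * f x ^ (p - 2)) (Set.Icc 0 L) :=
    continuousOn_const.mul (h.continuousOn_rpow (p - 2))
  have hFTC := intervalIntegral.integral_eq_sub_of_hasDerivAt_of_le hL.le
    (h.continuousOn_deriv.div h.continuousOn fun x hx => (h.pos x hx).ne') hder
    ((hcont2.sub hcontp).intervalIntegrable_of_Icc hL.le)
  rw [intervalIntegral.integral_of_le hL.le, ← integral_Icc_eq_integral_Ioc,
    integral_sub hcont2.integrableOn_Icc hcontp.integrableOn_Icc] at hFTC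
  simp only [Pi.div_apply] at hFTC
  have hvol : volume.real (Set.Icc 0 L) = L := by
    simp [Measure.real, ENNReal.toReal_ofReal hL.le]
  have hconst : ∀ k : ℝ, IntegrableOn (fun _ : ℝ => k) (Set.Icc 0 L) := fun k =>
    integrableOn_const (by simp)
  -- Jensen's inequality
  have hJ : 2 * c * (L ^ 2 / M) ≤ ∫ x in Set.Icc 0 L, 2 * c / f x ^ 2 := by
    -- The tangent line bound `1/y ≥ 2m - m² y` at `y = f²`, with `1/m = M/L` the mean of `f²`.
    have h1 : ∫ x in Set.Icc 0 L, (2 * c * (2 * (L / M)) - 2 * c * (L / M) ^ 2 * f x ^ 2) ≤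
        ∫ x in Set.Icc 0 L, 2 * c / f x ^ 2 := by
      refine setIntegral_mono_on ((hconst _).sub (h.integrableOn_sq.const_mul _))
        hcont2.integrableOn_Icc measurableSet_Icc fun x hx => ?_
      have hfx := h.pos x hx
      have : 2 * c / f x ^ 2 - (2 * c * (2 * (L / M)) - 2 * c * (L / M) ^ 2 * f x ^ 2) =
          2 * c * (1 - L / M * f x ^ 2) ^ 2 / f x ^ 2 := by
        field_simp; ring
      have h2 : 0 ≤ 2 * c * (1 - L / M * f x ^ 2) ^ 2 / f x ^ 2 := by positivity
      linarith
    rw [integral_sub (hconst _) (h.integrableOn_sq.const_mul _), setIntegral_const,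
      integral_const_mul, hvol, smul_eq_mul, ← hM] at h1
    have h2 : L * (2 * c * (2 * (L / M))) - 2 * c * (L / M) ^ 2 * M = 2 * c * (L ^ 2 / M) := by
      field_simp; ring
    linarith
  have hP : ∫ x in Set.Icc 0 L, ρ * (1 - 2 / p) * f x ^ (p - 2) ≤ L + B := by
    have h1 : ∫ x in Set.Icc 0 L, ρ * (1 - 2 / p) * f x ^ (p - 2) ≤
        ∫ x in Set.Icc 0 L, (1 + f x ^ p) := by
      refine setIntegral_mono_on hcontp.integrableOn_Icc ((hconst _).add (h.integrableOn_rpow p))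
        measurableSet_Icc fun x hx => ?_
      have hfx := h.pos x hx
      have hq : 0 < f x ^ (p - 2) := Real.rpow_pos_of_pos hfx _
      have h2 : 0 ≤ 2 / p := by positivity
      have h3 : 2 / p ≤ 1 := by rw [div_le_one hp0]; linarith
      have h4 : ρ * (1 - 2 / p) ≤ 1 := by nlinarith
      have h5 : ρ * (1 - 2 / p) * f x ^ (p - 2) ≤ f x ^ (p - 2) := by nlinarith
      have h6 : f x ^ (p - 2) ≤ 1 + f x ^ p := by
        rcases le_total (f x) 1 with h7 | h7
        · have := Real.rpow_le_one hfx.le h7 (by linarith : 0 ≤ p - 2)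
          have := Real.rpow_pos_of_pos hfx p
          linarith
        · have := Real.rpow_le_rpow_of_exponent_le h7 (by linarith : p - 2 ≤ p)
          linarith
      linarith
    rwa [integral_add (hconst _) (h.integrableOn_rpow p), setIntegral_const, hvol, smul_eq_mul,
      mul_one] at h1
  have hb1 := (abs_le.1 (hlog L (Set.right_mem_Icc.2 hL.le))).2
  have hb0 := (abs_le.1 (hlog 0 (Set.left_mem_Icc.2 hL.le))).1
  have hfin : 2 * c * (L ^ 2 / M) ≤ 2 * √l + (L + B) := by linarith
  have := mul_le_mul_of_nonneg_left hfin (show 0 ≤ M / L by positivity)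
  calc 2 * c * L = M / L * (2 * c * (L ^ 2 / M)) := by field_simp
    _ ≤ M / L * (2 * √l + (L + B)) := this
    _ = _ := by field_simp; ring

/-- Lower bound for the integral of the first integral of the equation. -/
theorem integral_energy_ge_Icc (h : IsNLSProfile p ρ l (Set.Icc 0 L) f w) (hL : 0 < L)
    (hp : 2 < p) (hρ0 : 0 ≤ ρ) (hρ1 : ρ ≤ 1) :
    -((∫ x in Set.Icc 0 L, f x ^ 2) *
        (√l / L + 1 / 2 + (∫ x in Set.Icc 0 L, f x ^ p) / (2 * L))) ≤
      1 / 2 * (∫ x in Set.Icc 0 L, w x ^ 2) + ρ / p * (∫ x in Set.Icc 0 L, f x ^ p)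
        - l / 2 * (∫ x in Set.Icc 0 L, f x ^ 2) := by
  set H := 1 / 2 * w 0 ^ 2 + ρ / p * f 0 ^ p - l / 2 * f 0 ^ 2 with hHdef
  have hconst : ∀ x ∈ Set.Icc 0 L,
      1 / 2 * w x ^ 2 + ρ / p * f x ^ p - l / 2 * f x ^ 2 = H := fun x hx =>
    h.energy_const (by linarith) Set.ordConnected_Icc hx (Set.left_mem_Icc.2 hL.le)
  have hvol : volume.real (Set.Icc 0 L) = L := by
    simp [Measure.real, ENNReal.toReal_ofReal hL.le]
  have hT : 1 / 2 * (∫ x in Set.Icc 0 L, w x ^ 2) + ρ / p * (∫ x in Set.Icc 0 L, f x ^ p)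
        - l / 2 * (∫ x in Set.Icc 0 L, f x ^ 2) = H * L := by
    have := setIntegral_congr_fun (μ := volume) measurableSet_Icc hconst
    rw [integral_sub, integral_add, integral_const_mul, integral_const_mul, integral_const_mul,
      setIntegral_const, hvol, smul_eq_mul] at this
    · linarith
    · exact h.integrableOn_deriv_sq.const_mul _
    · exact (h.integrableOn_rpow p).const_mul _
    · exact (h.integrableOn_deriv_sq.const_mul _).add ((h.integrableOn_rpow p).const_mul _)
    · exact h.integrableOn_sq.const_mul _
  rw [hT]
  have hB : 0 ≤ ∫ x in Set.Icc 0 L, f x ^ p := setIntegral_nonneg measurableSet_Icc fun x hx =>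
    (Real.rpow_pos_of_pos (h.pos x hx) p).le
  have hM := h.integral_sq_pos hL
  rcases le_total 0 H with hH | hH
  · have : 0 ≤ (∫ x in Set.Icc 0 L, f x ^ 2) *
        (√l / L + 1 / 2 + (∫ x in Set.Icc 0 L, f x ^ p) / (2 * L)) := by positivity
    have : 0 ≤ H * L := by positivity
    linarith
  · have := h.neg_energy_le hL hp hρ0 hρ1 (neg_nonneg.2 hH)
      (fun x hx => by rw [hconst x hx, neg_neg])
    have e : (∫ x in Set.Icc 0 L, f x ^ 2) *
      (2 * √l / L + 1 + (∫ x in Set.Icc 0 L, f x ^ p) / L) = 2 * ((∫ x in Set.Icc 0 L, f x ^ 2) *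
        (√l / L + 1 / 2 + (∫ x in Set.Icc 0 L, f x ^ p) / (2 * L))) := by
      field_simp
    linarith

end Bounded

/-! ### Half-lines -/

section HalfLine

/-- The flux `f f'` and its derivative are both integrable, so the flux tends to `0` at infinity and
only the boundary term at `0` remains. -/
theorem integral_identity_Ici (h : IsNLSProfile p ρ l (Set.Ici 0) f w)
    (hf : IntegrableOn (fun x => f x ^ 2) (Set.Ici 0))
    (hw : IntegrableOn (fun x => w x ^ 2) (Set.Ici 0))
    (hfp : IntegrableOn (fun x => f x ^ p) (Set.Ici 0)) :
    (∫ x in Set.Ici 0, w x ^ 2) + l * (∫ x in Set.Ici 0, f x ^ 2)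
      - ρ * (∫ x in Set.Ici 0, f x ^ p) = -(f 0 * w 0) := by
  have hder : ∀ x ∈ Set.Ioi 0, HasDerivAt (fun z => f z * w z)
      (w x ^ 2 + l * f x ^ 2 - ρ * f x ^ p) x := fun x hx =>
    h.hasDerivAt_mul (by rwa [interior_Ici])
  have hint : IntegrableOn (fun x => w x ^ 2 + l * f x ^ 2 - ρ * f x ^ p) (Set.Ici 0) :=
    (hw.add (hf.const_mul l)).sub (hfp.const_mul ρ)
  have hint' := hint.mono_set Set.Ioi_subset_Ici_self
  have hc := h.continuousOn.mul h.continuousOn_deriv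
  have hfw : IntegrableOn (fun x => f x * w x) (Set.Ici 0) := by
    refine Integrable.mono' (hf.add hw) (hc.aestronglyMeasurable measurableSet_Ici)
      (Filter.Eventually.of_forall fun x => ?_)
    simp only [Pi.add_apply, Real.norm_eq_abs]
    rw [abs_le]
    constructor <;> nlinarith [sq_nonneg (f x + w x), sq_nonneg (f x - w x),
        sq_nonneg (f x), sq_nonneg (w x)]
  have hlim := tendsto_zero_of_hasDerivAt_of_integrableOn_Ioi hder hint'
    (hfw.mono_set Set.Ioi_subset_Ici_self)
  have := integral_Ioi_of_hasDerivAt_of_tendsto (hc 0 Set.self_mem_Ici) hder hint' hlim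
  rw [← integral_Ici_eq_integral_Ioi, integral_sub, integral_add hw (hf.const_mul l),
    integral_const_mul, integral_const_mul] at this
  · rw [this]
    simp
  · exact hw.add (hf.const_mul l)
  · exact hfp.const_mul ρ

/-- The first integral is a constant that is integrable on a set of infinite measure, hence zero. -/
theorem integral_energy_Ici (h : IsNLSProfile p ρ l (Set.Ici 0) f w) (hp : p ≠ 0)
    (hf : IntegrableOn (fun x => f x ^ 2) (Set.Ici 0))
    (hw : IntegrableOn (fun x => w x ^ 2) (Set.Ici 0))
    (hfp : IntegrableOn (fun x => f x ^ p) (Set.Ici 0)) :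
    1 / 2 * (∫ x in Set.Ici 0, w x ^ 2) + ρ / p * (∫ x in Set.Ici 0, f x ^ p)
        - l / 2 * (∫ x in Set.Ici 0, f x ^ 2) = 0 := by
  set H := 1 / 2 * w 0 ^ 2 + ρ / p * f 0 ^ p - l / 2 * f 0 ^ 2 with hHdef
  have hconst : ∀ x ∈ Set.Ici 0,
      1 / 2 * w x ^ 2 + ρ / p * f x ^ p - l / 2 * f x ^ 2 = H := fun x hx =>
    h.energy_const hp Set.ordConnected_Ici hx Set.self_mem_Ici
  have hint : IntegrableOn (fun x => 1 / 2 * w x ^ 2 + ρ / p * f x ^ p - l / 2 * f x ^ 2)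
      (Set.Ici 0) :=
    ((hw.const_mul _).add (hfp.const_mul _)).sub (hf.const_mul _)
  have hH : H = 0 := by
    have := (integrableOn_congr_fun hconst measurableSet_Ici).1 hint
    rw [integrableOn_const_iff] at this
    simpa using this
  have := setIntegral_congr_fun (μ := volume) measurableSet_Ici hconst
  rw [integral_sub, integral_add (hw.const_mul _) (hfp.const_mul _), integral_const_mul,
    integral_const_mul, integral_const_mul, hH, integral_zero] at this
  · exact this
  · exact (hw.const_mul _).add (hfp.const_mul _)
  · exact hf.const_mul _

end HalfLine

end IsNLSProfile

/-! ### Regrouping sums over edges by vertices -/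

/-- Meant for `π` sending an edge to one of its ends: the fibre over `none` collects the half-lines,
where the second boundary term is zero. -/
theorem tsum_eq_tsum_fiber_some {V E : Type*} (π : E → Option V) {g : E → ℝ} (hg : Summable g)
    (h0 : ∀ e, π e = none → g e = 0) :
    ∑' e, g e = ∑' v, ∑' e : {e // π e = some v}, g e := by
  have h1 : ∑' e, g e = ∑' o, ∑' e : {e // π e = o}, g e := by
    rw [← (Equiv.sigmaFiberEquiv π).tsum_eq]
    exact Summable.tsum_sigma ((Equiv.sigmaFiberEquiv π).summable_iff.2 hg)
  rw [h1]
  refine (Function.Injective.tsum_eq (Option.some_injective V) fun o ho => ?_).symm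
  cases o with
  | some v => exact ⟨v, rfl⟩
  | none =>
    refine absurd ?_ ho
    exact (tsum_congr fun e : {e // π e = none} => h0 e e.2).trans tsum_zero

theorem tsum_subtype_eq_finsum_mem {E : Type*} {s : Set E} (hs : s.Finite) (g : E → ℝ) :
    ∑' e : s, g e = ∑ᶠ e ∈ s, g e := by
  have := hs.fintype
  rw [tsum_fintype, ← finsum_eq_sum_of_fintype, finsum_set_coe_eq_finsum_mem]

/-! ### Edges as intervals, and oscillation on a connected graph -/

namespace MetricGraph

variable {V E : Type*} {G : MetricGraph V E}

theorem edge_eq_Icc {e : E} (h : G.length e ≠ ⊤) : G.edge e = Set.Icc 0 (G.endCoord e) := by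
  ext x
  simp only [edge, Set.mem_ofPred_eq, Set.mem_Icc, endCoord]
  exact and_congr_right fun _ => ENNReal.ofReal_le_iff_le_toReal h

theorem edge_eq_Ici {e : E} (h : G.length e = ⊤) : G.edge e = Set.Ici 0 := by
  ext x
  simp [edge, h]

theorem edgeInterior_eq_Ioo {e : E} (h : G.length e ≠ ⊤) :
    G.edgeInterior e = Set.Ioo 0 (G.endCoord e) := by
  ext x
  simp only [edgeInterior, Set.mem_ofPred_eq, Set.mem_Ioo, endCoord]
  exact and_congr_right fun h0 => ENNReal.ofReal_lt_iff_lt_toReal h0.le h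

theorem edgeInterior_eq_Ioi {e : E} (h : G.length e = ⊤) : G.edgeInterior e = Set.Ioi 0 := by
  ext x
  simp [edgeInterior, h]

theorem ordConnected_edge (e : E) : (G.edge e).OrdConnected := by
  by_cases h : G.length e = ⊤
  · rw [edge_eq_Ici h]; exact Set.ordConnected_Ici
  · rw [edge_eq_Icc h]; exact Set.ordConnected_Icc

theorem measurableSet_edge (e : E) : MeasurableSet (G.edge e) :=
  (ordConnected_edge e).measurableSet

theorem zero_mem_edge (e : E) : (0 : ℝ) ∈ G.edge e := by simp [edge]

theorem le_endCoord {e₀ : ℝ} {e : E} (he : ENNReal.ofReal e₀ ≤ G.length e)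
    (h : G.length e ≠ ⊤) : e₀ ≤ G.endCoord e :=
  (ENNReal.ofReal_le_iff_le_toReal h).1 he

theorem length_ne_top {e : E} {v : V} (h : G.term e = some v) : G.length e ≠ ⊤ := fun h' => by
  rw [(G.term_eq_none_iff e).2 h'] at h
  cases h

/-- In a connected graph the oscillation of a function on the vertices is at most the total of its
variations along the edges: every intermediate value is crossed by some edge. -/
theorem sub_le_tsum_of_connected [Countable E] (hG : ∀ v w : V, Relation.EqvGen G.Joined v w)
    {F : V → ℝ} {g : E → ℝ} (hg : Summable g) (hg0 : ∀ e, 0 ≤ g e)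
    (hF : ∀ e v, G.term e = some v → |F (G.init e) - F v| ≤ g e) (v w : V) :
    F w - F v ≤ ∑' e, g e := by
  set I : E → Set ℝ := fun e => (G.term e).elim ∅ fun v => Set.uIcc (F (G.init e)) (F v) with hI
  have hcover : Set.Ico (F v) (F w) ⊆ ⋃ e, I e := by
    intro t ht
    by_contra hcon
    simp only [Set.mem_iUnion, not_exists] at hcon
    -- If no edge crosses the value `t`, the sublevel set `{F ≤ t}` contains both ends of an edge or
    -- neither. By connectedness it cannot separate `v` from `w`.
    have hstep : ∀ a b, G.Joined a b → (F a ≤ t ↔ F b ≤ t) := by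
      rintro a b ⟨e, rfl, hb⟩
      have h1 := hcon e
      simp only [hI, hb, Option.elim_some, Set.mem_uIcc, not_or, not_and, not_le] at h1
      constructor
      · intro h2
        exact (h1.1 h2).le
      · intro h2
        exact (h1.2 h2).le
    have hall : ∀ a b, Relation.EqvGen G.Joined a b → (F a ≤ t ↔ F b ≤ t) := by
      intro a b hab
      induction hab with
      | rel a b h => exact hstep a b h
      | refl a => exact Iff.rfl
      | symm a b _ ih => exact ih.symm
      | trans a b c _ _ ih1 ih2 => exact ih1.trans ih2
    exact absurd ((hall v w (hG v w)).1 ht.1) (not_le.2 ht.2)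
  have hvol : ∀ e, volume (I e) ≤ ENNReal.ofReal (g e) := by
    intro e
    cases hte : G.term e with
    | none => simp [hI, hte]
    | some b =>
      simp only [hI, hte, Option.elim_some, Set.uIcc, Real.volume_Icc, sup_sub_inf_eq_abs_sub]
      refine ENNReal.ofReal_le_ofReal ?_
      rw [abs_sub_comm]
      exact hF e b hte
  -- Countable subadditivity of Lebesgue measure replaces the choice of a path without repeated
  -- edges.
  have h1 : ENNReal.ofReal (F w - F v) ≤ ENNReal.ofReal (∑' e, g e) := by
    rw [← Real.volume_Ico, ENNReal.ofReal_tsum_of_nonneg hg0 hg]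
    exact (measure_mono hcover).trans ((measure_iUnion_le _).trans (ENNReal.tsum_le_tsum hvol))
  exact (ENNReal.ofReal_le_ofReal_iff (tsum_nonneg hg0)).1 h1

namespace IsSolution

variable {p ρ l : ℝ} {u : E → ℝ → ℝ}

theorem isNLSProfile (hu : G.IsSolution p ρ l u) {e₀ : ℝ} (he₀ : 0 < e₀) {e : E}
    (he : ENNReal.ofReal e₀ ≤ G.length e) :
    IsNLSProfile p ρ l (G.edge e) (u e) (derivWithin (u e) (G.edge e)) := by
  have hd := hu.differentiableOn e
  have hpos := hu.pos e
  have h2 := hu.differentiableAt_deriv e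
  have heq := hu.equation e
  by_cases h : G.length e = ⊤
  · rw [edge_eq_Ici h] at *
    rw [edgeInterior_eq_Ioi h] at *
    exact isNLSProfile_Ici hd hpos h2 heq
  · rw [edge_eq_Icc h] at *
    rw [edgeInterior_eq_Ioo h] at *
    exact isNLSProfile_Icc (he₀.trans_le (le_endCoord he h)) hd hpos h2 heq

/-- At an endpoint `deriv` depends on the values of `u e` off the edge, but the endpoints are a null
set. This reconciles the energy, written with `deriv`, with the one-sided derivatives in the
Kirchhoff condition. -/
theorem deriv_ae_eq (hP : IsNLSProfile p ρ l (G.edge e) (u e) (derivWithin (u e) (G.edge e))) :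
    deriv (u e) =ᵐ[volume.restrict (G.edge e)] derivWithin (u e) (G.edge e) := by
  have h0 : volume (frontier (G.edge e)) = 0 :=
    (ordConnected_edge e).convex.addHaar_frontier volume
  rw [Filter.EventuallyEq, ae_restrict_iff' (measurableSet_edge e)]
  filter_upwards [measure_eq_zero_iff_ae_notMem.1 h0] with x hx hxe
  refine (hP.hasDerivAt x ?_).deriv
  by_contra hxi
  exact hx ⟨subset_closure hxe, hxi⟩

end IsSolution

end MetricGraph

/-! ### Supremum and power bounds for solutions -/

namespace MetricGraph

variable {V E : Type*} {G : MetricGraph V E}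

/-- An `L²` function takes small values somewhere on a half-line, and also somewhere on a graph with
infinitely many edges of length bounded below. -/
theorem exists_sq_lt {u : E → ℝ → ℝ} {e₀ : ℝ} (he₀ : 0 < e₀)
    (hlen : ∀ e, ENNReal.ofReal e₀ ≤ G.length e) (hG : (∃ e, G.length e = ⊤) ∨ Infinite E)
    (hint : ∀ e, IntegrableOn (fun x => u e x ^ 2) (G.edge e))
    (hsum : Summable fun e => ∫ x in G.edge e, u e x ^ 2) {ε : ℝ} (hε : 0 < ε) :
    ∃ e, ∃ y ∈ G.edge e, u e y ^ 2 < ε := by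
  by_contra! hcon
  have key : ∀ e, ∀ R, 0 ≤ R → Set.Icc 0 R ⊆ G.edge e →
      R * ε ≤ ∫ x in G.edge e, u e x ^ 2 := by
    intro e R hR hsub
    have h1 : ∫ _ in Set.Icc 0 R, ε ≤ ∫ x in Set.Icc 0 R, u e x ^ 2 :=
      setIntegral_mono_on (integrableOn_const (by simp)) ((hint e).mono_set hsub)
        measurableSet_Icc fun x hx => hcon e x (hsub hx)
    have h2 : ∫ x in Set.Icc 0 R, u e x ^ 2 ≤ ∫ x in G.edge e, u e x ^ 2 :=
      setIntegral_mono_set (hint e) (Filter.Eventually.of_forall fun x => sq_nonneg _)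
        (Filter.Eventually.of_forall hsub)
    rw [setIntegral_const] at h1
    simp only [Measure.real, Real.volume_Icc, sub_zero, ENNReal.toReal_ofReal hR,
      smul_eq_mul] at h1
    exact h1.trans h2
  rcases hG with ⟨e, he⟩ | hE
  · set I := ∫ x in G.edge e, u e x ^ 2 with hI
    have hI0 : 0 ≤ I := setIntegral_nonneg (measurableSet_edge e) fun x _ => sq_nonneg _
    have := key e ((I + 1) / ε) (by positivity) (by
      rw [edge_eq_Ici he]; exact Set.Icc_subset_Ici_self)
    rw [div_mul_cancel₀ _ hε.ne'] at this
    linarith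
  -- The masses of the edges tend to zero, whereas each would be at least `e₀ * ε`.
  · have h1 := hsum.tendsto_cofinite_zero.eventually
      (gt_mem_nhds (show 0 < e₀ * ε by positivity))
    obtain ⟨e, he⟩ := h1.exists
    refine absurd he (not_lt.2 (key e e₀ he₀.le fun x hx => ⟨hx.1, ?_⟩))
    exact (ENNReal.ofReal_le_ofReal hx.2).trans (hlen e)

namespace IsSolution

variable {p ρ l : ℝ} {u : E → ℝ → ℝ}

theorem integrableOn_sq (hu : G.IsSolution p ρ l u) (e : E) :
    IntegrableOn (fun x => u e x ^ 2) (G.edge e) :=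
  (hu.memH1.memL2.1 e).integrable_sq

theorem integral_derivWithin_sq
    {e : E} (hP : IsNLSProfile p ρ l (G.edge e) (u e) (derivWithin (u e) (G.edge e))) :
    ∫ x in G.edge e, derivWithin (u e) (G.edge e) x ^ 2 = ∫ x in G.edge e, deriv (u e) x ^ 2 :=
  integral_congr_ae ((deriv_ae_eq hP).symm.fun_comp (· ^ 2))

theorem integrableOn_derivWithin_sq (hu : G.IsSolution p ρ l u) {e : E}
    (hP : IsNLSProfile p ρ l (G.edge e) (u e) (derivWithin (u e) (G.edge e))) :
    IntegrableOn (fun x => derivWithin (u e) (G.edge e) x ^ 2) (G.edge e) :=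
  (integrableOn_congr_fun_ae ((deriv_ae_eq hP).fun_comp (· ^ 2))).1
    (hu.memH1.memL2_deriv.1 e).integrable_sq

/-- A Gagliardo–Nirenberg inequality for the supremum of a solution on a noncompact graph. -/
theorem sq_le (hu : G.IsSolution p ρ l u) (hA : G.IsAdmissible) {e₀ : ℝ} (he₀ : 0 < e₀)
    (hlen : ∀ e, ENNReal.ofReal e₀ ≤ G.length e) (hG : (∃ e, G.length e = ⊤) ∨ Infinite E)
    {t : ℝ} (ht : 0 < t) {e : E} {x : ℝ} (hx : x ∈ G.edge e) :
    u e x ^ 2 ≤ 3 * (t * G.mass u + G.integral (fun e => fun x => deriv (u e) x ^ 2) / t) := by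
  have := hA.countable_edges
  have hP := fun e => hu.isNLSProfile he₀ (hlen e)
  have hs1 : Summable fun e => ∫ x in G.edge e, u e x ^ 2 := hu.memH1.memL2.2
  have hs2 : Summable fun e => ∫ x in G.edge e, deriv (u e) x ^ 2 := hu.memH1.memL2_deriv.2
  set D : E → ℝ := fun e =>
    t * (∫ x in G.edge e, u e x ^ 2) + (∫ x in G.edge e, deriv (u e) x ^ 2) / t with hD
  have hDs : Summable D := (hs1.mul_left t).add (hs2.div_const t)
  have hDsum : ∑' e, D e =
      t * G.mass u + G.integral (fun e => fun x => deriv (u e) x ^ 2) / t := by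
    rw [hD, (hs1.mul_left t).tsum_add (hs2.div_const t), tsum_mul_left, tsum_div_const]
    rfl
  have hD0 : ∀ e, 0 ≤ D e := fun e => by
    have h1 : 0 ≤ ∫ x in G.edge e, u e x ^ 2 := integral_nonneg fun x => sq_nonneg _
    have h2 : 0 ≤ ∫ x in G.edge e, deriv (u e) x ^ 2 := integral_nonneg fun x => sq_nonneg _
    simp only [hD]
    positivity
  have hosc : ∀ e, ∀ x ∈ G.edge e, ∀ y ∈ G.edge e, |u e x ^ 2 - u e y ^ 2| ≤ D e := by
    intro e x hx y hy
    have := (hP e).abs_sq_sub_sq_le (ordConnected_edge e) (hu.integrableOn_sq e)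
      (hu.integrableOn_derivWithin_sq (hP e)) ht hx hy
    rwa [integral_derivWithin_sq (hP e)] at this
  have hle : ∀ e, D e ≤ ∑' e, D e := fun e => hDs.le_tsum e fun i _ => hD0 i
  obtain ⟨F, hF⟩ := hu.memH1.agreesAtVertices
  have hconn := sub_le_tsum_of_connected hA.connected (F := fun v => F v ^ 2) hDs hD0
    (fun e v hv => by
      have hend : G.endCoord e ∈ G.edge e := by
        rw [edge_eq_Icc (length_ne_top hv)]
        exact ⟨ENNReal.toReal_nonneg, le_rfl⟩
      have := hosc e 0 (zero_mem_edge e) _ hend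
      rwa [(hF e).1, (hF e).2 v hv] at this)
  rw [← hDsum]
  refine le_of_forall_pos_le_add fun ε hε => ?_
  -- Three moves, each costing at most `∑' e, D e`, hence the factor 3: from `x` to a vertex, from
  -- there to a vertex of `e'`, then to `y`.
  obtain ⟨e', y, hy, hyε⟩ := exists_sq_lt he₀ hlen hG hu.integrableOn_sq hs1 hε
  have h1 := (abs_le.1 (hosc e x hx 0 (zero_mem_edge e))).2
  have h2 := (abs_le.1 (hosc e' 0 (zero_mem_edge e') y hy)).2
  have h3 := hconn (G.init e') (G.init e)
  rw [(hF e).1] at h1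
  rw [(hF e').1] at h2
  have h4 := hle e
  have h5 := hle e'
  linarith

theorem integral_abs_rpow (hu : G.IsSolution p ρ l u) (e : E) :
    ∫ x in G.edge e, |u e x| ^ p = ∫ x in G.edge e, u e x ^ p :=
  setIntegral_congr_fun (measurableSet_edge e) fun x hx => by
    simp only [abs_of_pos (hu.pos e x hx)]

theorem rpow_le (hu : G.IsSolution p ρ l u) {M q : ℝ} (hq : 0 ≤ q)
    (hM : ∀ e, ∀ x ∈ G.edge e, u e x ^ 2 ≤ M) {e : E} {x : ℝ} (hx : x ∈ G.edge e) :
    u e x ^ (2 * q + 2) ≤ M ^ q * u e x ^ 2 := by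
  have hpos := hu.pos e x hx
  rw [Real.rpow_add hpos, Real.rpow_mul hpos.le, Real.rpow_two]
  exact mul_le_mul_of_nonneg_right
    (Real.rpow_le_rpow (sq_nonneg _) (hM e x hx) hq) (sq_nonneg _)

theorem integrableOn_rpow (hu : G.IsSolution p ρ l u) {M : ℝ} (hp : 2 ≤ p)
    (hM : ∀ e, ∀ x ∈ G.edge e, u e x ^ 2 ≤ M) (e : E) :
    IntegrableOn (fun x => u e x ^ p) (G.edge e) := by
  have hc : ContinuousOn (fun x => u e x ^ p) (G.edge e) :=
    (hu.differentiableOn e).continuousOn.rpow_const fun x hx => Or.inl (hu.pos e x hx).ne'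
  refine Integrable.mono' ((hu.integrableOn_sq e).const_mul (M ^ ((p - 2) / 2)))
    (hc.aestronglyMeasurable (measurableSet_edge e))
    (ae_restrict_of_forall_mem (measurableSet_edge e) fun x hx => ?_)
  rw [Real.norm_of_nonneg (Real.rpow_nonneg (hu.pos e x hx).le _)]
  have := hu.rpow_le (q := (p - 2) / 2) (by linarith) hM hx
  rwa [show 2 * ((p - 2) / 2) + 2 = p by ring] at this

theorem integral_rpow_le (hu : G.IsSolution p ρ l u) {M : ℝ} (hp : 2 ≤ p)
    (hM : ∀ e, ∀ x ∈ G.edge e, u e x ^ 2 ≤ M) (e : E) :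
    ∫ x in G.edge e, u e x ^ p ≤ M ^ ((p - 2) / 2) * ∫ x in G.edge e, u e x ^ 2 := by
  rw [← integral_const_mul]
  refine setIntegral_mono_on (hu.integrableOn_rpow hp hM e)
    ((hu.integrableOn_sq e).const_mul _) (measurableSet_edge e) fun x hx => ?_
  have := hu.rpow_le (q := (p - 2) / 2) (by linarith) hM hx
  rwa [show 2 * ((p - 2) / 2) + 2 = p by ring] at this

theorem integral_rpow_nonneg (hu : G.IsSolution p ρ l u) (e : E) :
    0 ≤ ∫ x in G.edge e, u e x ^ p :=
  setIntegral_nonneg (measurableSet_edge e) fun x hx => Real.rpow_nonneg (hu.pos e x hx).le _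

theorem summable_rpow (hu : G.IsSolution p ρ l u) {M : ℝ} (hp : 2 ≤ p)
    (hM : ∀ e, ∀ x ∈ G.edge e, u e x ^ 2 ≤ M) :
    Summable fun e => ∫ x in G.edge e, u e x ^ p :=
  Summable.of_nonneg_of_le hu.integral_rpow_nonneg (hu.integral_rpow_le hp hM)
    (hu.memH1.memL2.2.mul_left _)

/-! ### Kirchhoff conditions and identities summed over the graph -/

/-- The sum of the boundary terms of `u u'` vanishes by the Kirchhoff conditions. -/
theorem tsum_boundary_eq (hu : G.IsSolution p ρ l u) (hA : G.IsAdmissible)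
    {a b : E → ℝ} (ha : Summable a) (hb : Summable b)
    (haeq : ∀ e, a e = u e 0 * derivWithin (u e) (G.edge e) 0)
    (hbeq : ∀ e v, G.term e = some v →
      b e = u e (G.endCoord e) * derivWithin (u e) (G.edge e) (G.endCoord e))
    (hb0 : ∀ e, G.term e = none → b e = 0) :
    ∑' e, b e = ∑' e, a e := by
  obtain ⟨F, hF⟩ := hu.memH1.agreesAtVertices
  -- At a vertex `v` all boundary terms share the factor `F v`, so the Kirchhoff condition equates
  -- the two fibre sums.
  rw [tsum_eq_tsum_fiber_some G.term hb hb0,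
    tsum_eq_tsum_fiber_some (fun e => some (G.init e)) ha (by simp)]
  refine tsum_congr fun v => ?_
  have hfin := hA.finite_degree v
  have hf1 : {e | G.init e = v}.Finite := hfin.subset fun e he => Or.inl he
  have hf2 : {e | G.term e = some v}.Finite := hfin.subset fun e he => Or.inr he
  have h1 : ∑' e : {e // some (G.init e) = some v}, a e =
      F v * ∑ᶠ e ∈ {e | G.init e = v}, derivWithin (u e) (G.edge e) 0 := by
    have hset : {e | some (G.init e) = some v} = {e | G.init e = v} := by ext; simp
    refine (tsum_subtype_eq_finsum_mem (s := {e | some (G.init e) = some v}) (hset ▸ hf1) a).trans ?_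
    rw [mul_finsum_mem]
    refine finsum_mem_congr hset fun e he => ?_
    rw [haeq, (hF e).1, he]
  have h2 : ∑' e : {e // G.term e = some v}, b e =
      F v * ∑ᶠ e ∈ {e | G.term e = some v},
        derivWithin (u e) (G.edge e) (G.endCoord e) := by
    refine (tsum_subtype_eq_finsum_mem hf2 b).trans ?_
    rw [mul_finsum_mem]
    refine finsum_mem_congr rfl fun e he => ?_
    rw [hbeq e v he, (hF e).2 v he]
  have hK := hu.kirchhoff v
  rw [outgoingDerivSum, finsum_mem_neg_distrib _ hf2] at hK
  rw [h1, h2]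
  congr 1
  linarith

/-- The equation tested with the solution itself, on the whole graph. -/
theorem integral_identity (hu : G.IsSolution p ρ l u) (hA : G.IsAdmissible) {e₀ : ℝ}
    (he₀ : 0 < e₀) (hlen : ∀ e, ENNReal.ofReal e₀ ≤ G.length e) {M : ℝ} (hp : 2 ≤ p)
    (hM : ∀ e, ∀ x ∈ G.edge e, u e x ^ 2 ≤ M) :
    (∑' e, ∫ x in G.edge e, deriv (u e) x ^ 2) + l * (∑' e, ∫ x in G.edge e, u e x ^ 2) =
      ρ * ∑' e, ∫ x in G.edge e, u e x ^ p := by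
  have hP := fun e => hu.isNLSProfile he₀ (hlen e)
  have hs1 : Summable fun e => ∫ x in G.edge e, u e x ^ 2 := hu.memH1.memL2.2
  have hs2 : Summable fun e => ∫ x in G.edge e, deriv (u e) x ^ 2 := hu.memH1.memL2_deriv.2
  have hs3 := hu.summable_rpow hp hM
  have hn1 : ∀ e, 0 ≤ ∫ x in G.edge e, u e x ^ 2 := fun e => integral_nonneg fun x => sq_nonneg _
  have hn2 : ∀ e, 0 ≤ ∫ x in G.edge e, deriv (u e) x ^ 2 :=
    fun e => integral_nonneg fun x => sq_nonneg _
  have hn3 := hu.integral_rpow_nonneg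
  set a : E → ℝ := fun e => u e 0 * derivWithin (u e) (G.edge e) 0 with ha
  set b : E → ℝ := fun e => (G.term e).elim 0 fun _ =>
    u e (G.endCoord e) * derivWithin (u e) (G.edge e) (G.endCoord e) with hb
  -- A summable majorant of both boundary terms: the flux bound with the edge length replaced by
  -- `e₀`. It allows `∑' e, (b e - a e)` to be split.
  set Q : E → ℝ := fun e => ((∫ x in G.edge e, u e x ^ 2) + ∫ x in G.edge e, deriv (u e) x ^ 2) / e₀
    + ((∫ x in G.edge e, deriv (u e) x ^ 2) + |l| * (∫ x in G.edge e, u e x ^ 2)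
      + |ρ| * ∫ x in G.edge e, u e x ^ p) with hQ
  have hQs : Summable Q := ((hs1.add hs2).div_const e₀).add
    ((hs2.add (hs1.mul_left _)).add (hs3.mul_left _))
  have hbounded : ∀ e v, G.term e = some v →
      ((∫ x in G.edge e, deriv (u e) x ^ 2) + l * (∫ x in G.edge e, u e x ^ 2)
        - ρ * ∫ x in G.edge e, u e x ^ p = b e - a e) ∧ |a e| ≤ Q e ∧ |b e| ≤ Q e := by
    intro e v hv
    have hne := length_ne_top hv
    have hL := he₀.trans_le (le_endCoord (hlen e) hne)
    have hprof := hP e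
    have hb' : b e = u e (G.endCoord e) * derivWithin (u e) (G.edge e) (G.endCoord e) := by
      simp [hb, hv]
    have hint := integral_derivWithin_sq hprof
    have hQ' : ((∫ x in G.edge e, u e x ^ 2) + ∫ x in G.edge e, deriv (u e) x ^ 2)
        / G.endCoord e + ((∫ x in G.edge e, deriv (u e) x ^ 2)
          + |l| * (∫ x in G.edge e, u e x ^ 2) + |ρ| * ∫ x in G.edge e, u e x ^ p) ≤ Q e := by
      have := div_le_div_of_nonneg_left (add_nonneg (hn1 e) (hn2 e)) he₀
        (le_endCoord (hlen e) hne)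
      simp only [hQ]
      linarith
    rw [hb']
    simp only [ha]
    rw [← hint] at hQ' ⊢
    have hedge := edge_eq_Icc hne
    generalize derivWithin (u e) (G.edge e) = w at *
    rw [hedge] at *
    exact ⟨hprof.integral_identity_Icc hL,
      (hprof.abs_mul_deriv_le hL (Set.left_mem_Icc.2 hL.le)).trans hQ',
      (hprof.abs_mul_deriv_le hL (Set.right_mem_Icc.2 hL.le)).trans hQ'⟩
  have hhalf : ∀ e, G.term e = none →
      ((∫ x in G.edge e, deriv (u e) x ^ 2) + l * (∫ x in G.edge e, u e x ^ 2)
        - ρ * ∫ x in G.edge e, u e x ^ p = b e - a e) ∧ |a e| ≤ Q e ∧ |b e| ≤ Q e := by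
    intro e hv
    have htop := (G.term_eq_none_iff e).1 hv
    have hprof := hP e
    have hb' : b e = 0 := by simp [hb, hv]
    have hid : (∫ x in G.edge e, deriv (u e) x ^ 2) + l * (∫ x in G.edge e, u e x ^ 2)
        - ρ * (∫ x in G.edge e, u e x ^ p) = -a e := by
      have h1 := hu.integrableOn_sq e
      have h2 := hu.integrableOn_derivWithin_sq hprof
      have h3 := hu.integrableOn_rpow hp hM e
      have hint := integral_derivWithin_sq hprof
      simp only [ha]
      rw [← hint]
      have hedge := edge_eq_Ici htop
      generalize derivWithin (u e) (G.edge e) = w at *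
      rw [hedge] at hprof h1 h2 h3 ⊢
      exact hprof.integral_identity_Ici h1 h2 h3
    have hfirst : 0 ≤ ((∫ x in G.edge e, u e x ^ 2) + ∫ x in G.edge e, deriv (u e) x ^ 2) / e₀ :=
      div_nonneg (add_nonneg (hn1 e) (hn2 e)) he₀.le
    have hl1 := mul_le_mul_of_nonneg_right (le_abs_self l) (hn1 e)
    have hl2 := mul_le_mul_of_nonneg_right (neg_abs_le l) (hn1 e)
    have hr1 := mul_le_mul_of_nonneg_right (le_abs_self ρ) (hn3 e)
    have hr2 := mul_le_mul_of_nonneg_right (neg_abs_le ρ) (hn3 e)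
    have haQ : |a e| ≤ Q e := by
      rw [abs_le]
      simp only [hQ]
      constructor <;> linarith [hn2 e]
    refine ⟨by rw [hid, hb', zero_sub], haQ, ?_⟩
    rw [hb', abs_zero]
    exact (abs_nonneg _).trans haQ
  have hall : ∀ e, ((∫ x in G.edge e, deriv (u e) x ^ 2) + l * (∫ x in G.edge e, u e x ^ 2)
        - ρ * ∫ x in G.edge e, u e x ^ p = b e - a e) ∧ |a e| ≤ Q e ∧ |b e| ≤ Q e := by
    intro e
    cases hv : G.term e with
    | none => exact hhalf e hv
    | some v => exact hbounded e v hv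
  have has : Summable a := Summable.of_norm_bounded hQs fun e => (hall e).2.1
  have hbs : Summable b := Summable.of_norm_bounded hQs fun e => (hall e).2.2
  have hbd := hu.tsum_boundary_eq hA has hbs (fun e => rfl) (fun e v hv => by simp [hb, hv])
    (fun e hv => by simp [hb, hv])
  have hsum : ∑' e, ((∫ x in G.edge e, deriv (u e) x ^ 2) + l * (∫ x in G.edge e, u e x ^ 2)
        - ρ * ∫ x in G.edge e, u e x ^ p) = ∑' e, (b e - a e) := tsum_congr fun e => (hall e).1
  rw [(hs2.add (hs1.mul_left l)).tsum_sub (hs3.mul_left ρ), hs2.tsum_add (hs1.mul_left l),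
    tsum_mul_left, tsum_mul_left, hbs.tsum_sub has, hbd, sub_self, sub_eq_zero] at hsum
  exact hsum

/-- Lower bound for the integral over an edge of the first integral of the equation. -/
theorem integral_energy_ge (hu : G.IsSolution p ρ l u) {e₀ : ℝ} (he₀ : 0 < e₀)
    (hlen : ∀ e, ENNReal.ofReal e₀ ≤ G.length e) {M : ℝ} (hp : 2 < p)
    (hM : ∀ e, ∀ x ∈ G.edge e, u e x ^ 2 ≤ M) (hρ0 : 0 ≤ ρ) (hρ1 : ρ ≤ 1) (e : E) :
    -((∫ x in G.edge e, u e x ^ 2) * (√l / e₀ + 1 / 2) +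
        G.mass u / (2 * e₀) * (∫ x in G.edge e, u e x ^ p)) ≤
      1 / 2 * (∫ x in G.edge e, deriv (u e) x ^ 2) + ρ / p * (∫ x in G.edge e, u e x ^ p)
        - l / 2 * (∫ x in G.edge e, u e x ^ 2) := by
  have hprof := hu.isNLSProfile he₀ (hlen e)
  have hn1 : ∀ e, 0 ≤ ∫ x in G.edge e, u e x ^ 2 := fun e => integral_nonneg fun x => sq_nonneg _
  have hn3 := hu.integral_rpow_nonneg e
  have hmass : ∫ x in G.edge e, u e x ^ 2 ≤ G.mass u :=
    hu.memH1.memL2.2.le_tsum e fun i _ => hn1 i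
  have hmass0 : 0 ≤ G.mass u := (hn1 e).trans hmass
  have hn1e := hn1 e
  have hint := integral_derivWithin_sq hprof
  rw [← hint]
  by_cases htop : G.length e = ⊤
  · have h1 := hu.integrableOn_sq e
    have h2 := hu.integrableOn_derivWithin_sq hprof
    have h3 := hu.integrableOn_rpow hp.le hM e
    have h4 : 0 ≤ (∫ x in G.edge e, u e x ^ 2) * (√l / e₀ + 1 / 2) +
        G.mass u / (2 * e₀) * (∫ x in G.edge e, u e x ^ p) := by positivity
    have h5 : 1 / 2 * (∫ x in G.edge e, derivWithin (u e) (G.edge e) x ^ 2)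
        + ρ / p * (∫ x in G.edge e, u e x ^ p) - l / 2 * (∫ x in G.edge e, u e x ^ 2) = 0 := by
      have hedge := edge_eq_Ici htop
      generalize derivWithin (u e) (G.edge e) = w at *
      rw [hedge] at hprof h1 h2 h3 ⊢
      exact hprof.integral_energy_Ici (by linarith) h1 h2 h3
    linarith
  · have hle := le_endCoord (hlen e) htop
    have hL := he₀.trans_le hle
    refine le_trans (neg_le_neg ?_) (?_ : -((∫ x in G.edge e, u e x ^ 2) *
        (√l / G.endCoord e + 1 / 2 + (∫ x in G.edge e, u e x ^ p) / (2 * G.endCoord e))) ≤ _)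
    · have h1 : √l / G.endCoord e ≤ √l / e₀ :=
        div_le_div_of_nonneg_left (Real.sqrt_nonneg _) he₀ hle
      have h2 : (∫ x in G.edge e, u e x ^ p) / (2 * G.endCoord e) ≤
          (∫ x in G.edge e, u e x ^ p) / (2 * e₀) :=
        div_le_div_of_nonneg_left hn3 (by positivity) (by linarith)
      -- Bounding the edge mass by the total mass in the product of two integrals makes the estimate
      -- linear in edge integrals, hence summable.
      calc _ ≤ (∫ x in G.edge e, u e x ^ 2) *
            (√l / e₀ + 1 / 2 + (∫ x in G.edge e, u e x ^ p) / (2 * e₀)) :=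
            mul_le_mul_of_nonneg_left (by linarith) hn1e
        _ = (∫ x in G.edge e, u e x ^ 2) * (√l / e₀ + 1 / 2) +
            (∫ x in G.edge e, u e x ^ 2) * ((∫ x in G.edge e, u e x ^ p) / (2 * e₀)) := by ring
        _ ≤ (∫ x in G.edge e, u e x ^ 2) * (√l / e₀ + 1 / 2) +
            G.mass u * ((∫ x in G.edge e, u e x ^ p) / (2 * e₀)) := by gcongr
        _ = _ := by ring
    · have hedge := edge_eq_Icc htop
      generalize derivWithin (u e) (G.edge e) = w at *
      rw [hedge] at *
      exact hprof.integral_energy_ge_Icc hL hp hρ0 hρ1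

/-! ### Positivity of the energy at small mass -/

theorem energy_pos (hu : G.IsSolution p ρ l u) (hA : G.IsAdmissible) {e₀ : ℝ} (he₀ : 0 < e₀)
    (hlen : ∀ e, ENNReal.ofReal e₀ ≤ G.length e) (hG : (∃ e, G.length e = ⊤) ∨ Infinite E)
    (hp : 6 < p) (hρ0 : 1 / 2 ≤ ρ) (hρ1 : ρ ≤ 1) (hμ0 : 0 < G.mass u) (hμ1 : G.mass u < 1 / 6)
    (hμ : G.mass u * (6 / e₀ + 18 + 1 / (2 * e₀)) < (p - 6) / (4 * p)) :
    0 < G.energy p ρ u := by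
  by_contra! hE
  have hp0 : 0 < p := by linarith
  have hs1 : Summable fun e => ∫ x in G.edge e, u e x ^ 2 := hu.memH1.memL2.2
  have hs2 : Summable fun e => ∫ x in G.edge e, deriv (u e) x ^ 2 := hu.memH1.memL2_deriv.2
  set μ := G.mass u with hμdef
  set A := G.integral (fun e => fun x => deriv (u e) x ^ 2) with hAdef
  have hA0 : 0 ≤ A := tsum_nonneg fun e => integral_nonneg fun x => sq_nonneg _
  -- The choice `t = 1` serves only to have some finite bound, which makes `B` a convergent sum.
  have hM1 : ∀ e, ∀ x ∈ G.edge e, u e x ^ 2 ≤ 3 * (1 * μ + A / 1) :=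
    fun e x hx => hu.sq_le hA he₀ hlen hG one_pos hx
  have hs3 := hu.summable_rpow (by linarith) hM1
  set B := ∑' e, ∫ x in G.edge e, u e x ^ p with hBdef
  have hB0 : 0 ≤ B := tsum_nonneg hu.integral_rpow_nonneg
  have hBint : G.integral (fun e x => |u e x| ^ p) = B :=
    tsum_congr fun e => hu.integral_abs_rpow e
  rw [energy, hBint, ← hAdef] at hE
  have hρp : 2 * (ρ / p) ≤ 1 := by
    rw [← mul_div_assoc, div_le_one hp0]; linarith
  have hAB : A ≤ 2 * (ρ / p) * B := by linarith
  have hAB' : A ≤ B := hAB.trans (mul_le_of_le_one_left hB0 hρp)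
  have hE' : Nonempty E := by
    by_contra hne
    rw [not_nonempty_iff] at hne
    simp [hμdef, mass, integral] at hμ0
  obtain ⟨e⟩ := hE'
  have hBpos : 0 < B := by
    refine hB0.lt_of_ne fun h0 => ?_
    have hA' : A = 0 := le_antisymm (h0 ▸ hAB') hA0
    have hpos := hu.pos e 0 (zero_mem_edge e)
    -- With `A = 0` this `t` would give `u² ≤ u² / 2` at a point where `u > 0`.
    have := hu.sq_le hA he₀ hlen hG (t := u e 0 ^ 2 / (6 * μ)) (by positivity) (zero_mem_edge e)
    rw [← hμdef, ← hAdef, hA', zero_div, add_zero] at this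
    have h2 : 3 * (u e 0 ^ 2 / (6 * μ) * μ) = u e 0 ^ 2 / 2 := by field_simp; norm_num
    have h3 : 0 < u e 0 ^ 2 := by positivity
    linarith
  -- the solution is concentrated: `B` is large compared to `μ`
  set s := √(B * μ) with hs
  have hs0 : 0 < s := Real.sqrt_pos.2 (by positivity)
  have hss : s * s = B * μ := Real.mul_self_sqrt (by positivity)
  have hM2 : ∀ e, ∀ x ∈ G.edge e, u e x ^ 2 ≤ 6 * s := by
    intro e x hx
    -- This `t` balances the two terms: `t μ = s`, and `A / t ≤ s` because `A ≤ B`.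
    have := hu.sq_le hA he₀ hlen hG (t := s / μ) (by positivity) hx
    rw [← hμdef, ← hAdef] at this
    have h1 : A / (s / μ) ≤ s := by
      rw [div_le_iff₀ (by positivity), ← mul_div_assoc, hss, mul_div_cancel_right₀ _ hμ0.ne']
      exact hAB'
    have h2 : s / μ * μ = s := div_mul_cancel₀ _ hμ0.ne'
    rw [h2] at this
    linarith
  -- Since `p > 6`, the exponent `(p - 2) / 2` exceeds 2. If `6 s ≤ 1`, then `B ≤ (6 s)² μ = 36 μ² B
  -- < B`.
  have hs6 : 1 < 6 * s := by
    by_contra! hle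
    have h1 : B ≤ (6 * s) ^ ((p - 2) / 2) * μ := by
      rw [hμdef, mass, integral, ← tsum_mul_left]
      exact hs3.tsum_le_tsum (hu.integral_rpow_le (by linarith) hM2) (hs1.mul_left _)
    have h2 : (6 * s) ^ ((p - 2) / 2) ≤ (6 * s) ^ (2 : ℝ) :=
      Real.rpow_le_rpow_of_exponent_ge (by positivity) hle (by linarith)
    rw [Real.rpow_two] at h2
    have h3 : B ≤ (6 * s) ^ 2 * μ := h1.trans (mul_le_mul_of_nonneg_right h2 hμ0.le)
    have h4 : (6 * s) ^ 2 * μ = B * (36 * μ ^ 2) := by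
      calc (6 * s) ^ 2 * μ = 36 * (s * s) * μ := by ring
        _ = _ := by rw [hss]; ring
    have h5 : 36 * μ ^ 2 < 1 := by nlinarith
    nlinarith
  -- From `6 s > 1` and `s² = B μ`, the terms `s` and `1` are absorbed into multiples of `B μ`.
  have hs_le : s ≤ 6 * (B * μ) := by nlinarith
  have hone : 1 ≤ 36 * (B * μ) := by nlinarith
  have hid : A + l * μ = ρ * B := hu.integral_identity hA he₀ hlen (by linarith) hM2
  have hsl : √l * μ ≤ s := by
    have h1 : l * μ ≤ B := by nlinarith
    have h2 : √l * μ = √l * √μ * √μ := by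
      rw [mul_assoc, Real.mul_self_sqrt hμ0.le]
    have h3 : √l * √μ ≤ √B := by
      rw [← Real.sqrt_mul' _ hμ0.le]
      exact Real.sqrt_le_sqrt h1
    rw [h2, hs, Real.sqrt_mul hBpos.le]
    exact mul_le_mul_of_nonneg_right h3 (Real.sqrt_nonneg _)
  have hT : -(μ * (√l / e₀ + 1 / 2) + μ / (2 * e₀) * B) ≤
      1 / 2 * A + ρ / p * B - l / 2 * μ := by
    have := Summable.tsum_le_tsum
      (hu.integral_energy_ge he₀ hlen (by linarith) hM2 (by linarith) hρ1)
      ((hs1.mul_right _).add (hs3.mul_left _)).neg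
      (((hs2.mul_left _).add (hs3.mul_left _)).sub (hs1.mul_left _))
    rwa [tsum_neg, (hs1.mul_right _).tsum_add (hs3.mul_left _),
      ((hs2.mul_left _).add (hs3.mul_left _)).tsum_sub (hs1.mul_left _),
      (hs2.mul_left _).tsum_add (hs3.mul_left _), tsum_mul_left, tsum_mul_left, tsum_mul_left,
      tsum_mul_left, tsum_mul_right] at this
  -- The right side equals `ρ (p - 6) / (2 p) · B`, and `ρ ≥ 1/2`.
  have hcoef : (p - 6) / (4 * p) * B ≤ ρ * B / 2 - 3 * (ρ / p * B) := by
    have h1 : ρ * B / 2 - 3 * (ρ / p * B) = (p - 6) / (4 * p) * B * (2 * ρ) := by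
      field_simp; ring
    rw [h1]
    have h2 : 0 ≤ (p - 6) / (4 * p) * B :=
      mul_nonneg (div_nonneg (by linarith) (by linarith)) hB0
    nlinarith
  -- Combines `hT` with `l μ = ρ B - A` and `A ≤ (2ρ/p) B`.
  have hchain : (p - 6) / (4 * p) * B ≤ s / e₀ + μ / 2 + μ / (2 * e₀) * B := by
    have h1 : μ * (√l / e₀) ≤ s / e₀ := by
      rw [← mul_div_assoc, mul_comm]
      exact div_le_div_of_nonneg_right hsl he₀.le
    linarith
  have hlast : s / e₀ + μ / 2 + μ / (2 * e₀) * B ≤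
      μ * (6 / e₀ + 18 + 1 / (2 * e₀)) * B := by
    have h1 : s / e₀ ≤ 6 * (B * μ) / e₀ := div_le_div_of_nonneg_right hs_le he₀.le
    have h2 : μ / 2 ≤ 18 * (B * μ) := by nlinarith
    have h3 : μ * (6 / e₀ + 18 + 1 / (2 * e₀)) * B =
        6 * (B * μ) / e₀ + 18 * (B * μ) + μ / (2 * e₀) * B := by ring
    linarith
  have := (mul_lt_mul_iff_of_pos_right hBpos).2 hμ
  linarith

end IsSolution

end MetricGraph

theorem corollary3p3 {V E : Type*} (G : MetricGraph V E) (hG : G.IsAdmissible)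
    (hG' : G.IsNoncompactFinite ∨ G.IsPeriodic) (p : ℝ) (hp : 6 < p) :
    ∃ μ₀ : ℝ, 0 < μ₀ ∧ ∀ μ : ℝ, 0 < μ → μ ≤ μ₀ →
      (∀ (u : E → ℝ → ℝ) (l : ℝ), G.IsSolution p 1 l u → G.mass u = μ → 0 < G.energy p 1 u) ∧
      (∀ ρ ∈ Set.Icc (1 / 2 : ℝ) 1, ∀ (u : E → ℝ → ℝ) (l : ℝ),
        G.IsSolution p ρ l u → G.mass u = μ → 0 < G.energy p ρ u) := by
  obtain ⟨e₀, he₀, hlen⟩ := hG.length_bounded_below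
  have hnc : (∃ e, G.length e = ⊤) ∨ Infinite E := by
    rcases hG' with h | ⟨n, _, _, h⟩
    · exact Or.inl h.2
    · exact Or.inr h.infinite_edges
  set K := 6 / e₀ + 18 + 1 / (2 * e₀) with hK
  have hK0 : 0 < K := by positivity
  have hc : 0 < (p - 6) / (4 * p) := div_pos (by linarith) (by linarith)
  -- The values `1/7` and `2 * K` leave room for the strict inequalities `μ < 1/6` and `μ K < (p -
  -- 6) / (4 p)`; the threshold does not depend on `ρ`.
  have main : ∀ μ : ℝ, 0 < μ → μ ≤ min (1 / 7) ((p - 6) / (4 * p) / (2 * K)) →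
      ∀ ρ ∈ Set.Icc (1 / 2 : ℝ) 1, ∀ (u : E → ℝ → ℝ) (l : ℝ),
        G.IsSolution p ρ l u → G.mass u = μ → 0 < G.energy p ρ u := by
    rintro μ hμ0 hμ ρ hρ u l hu rfl
    have h1 := hμ.trans (min_le_left _ _)
    have h2 := hμ.trans (min_le_right _ _)
    rw [le_div_iff₀ (by positivity)] at h2
    exact hu.energy_pos hG he₀ hlen hnc hp hρ.1 hρ.2 hμ0 (by linarith) (by nlinarith)
  refine ⟨min (1 / 7) ((p - 6) / (4 * p) / (2 * K)), by positivity, fun μ hμ0 hμ => ⟨?_, ?_⟩⟩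
  · exact main μ hμ0 hμ 1 (by norm_num)
  · exact main μ hμ0 hμ
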